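/- Let $\mathcal M$ be a complete connected (finite-dimensional, smooth) Riemannian manifold with distance $\mathrm{dist}$. For real weights $w_j$ and points $p_j\in\mathcal M$ (finitely many) let $\mathrm{mean}(w,p)=\operatorname{argmin}_{v\in\mathcal M}\sum_j w_j\,\mathrm{dist}(v,p_j)^2$ denote the set of all minimizers. **Grids.** Let $s,R\in\mathbb N$, $N'=(N'_1,\dots,N'_s)\in\mathbb N^s$ and $N=2^RN'$. A signal is $u\in\mathcal M^N$, i.e. $u=(u_n)_{0\le n<N}$ with multi-indices $n$. For $0\le r\le R$ put $\tilde u_{n,r}=u_{2^{R-r}n}$, $0\le n<2^rN'$. **Subdivision.** Let $a=(a_i)_{i\in\mathbb Z^s}$ be a finitely supported real mask with $\sum_{k}a_{n-2k}=1$ for all $n\in\mathbb Z^s$ and $a_{2i}=\delta_{i0}$. On the bounded grids, the scheme $\mathrm S$ is given by real weights $w^{r}_{n,k}$ ($r\ge1$, $0\le n<2^{r}N'$, $0\le k<2^{r-1}N'$) with $\sum_k w^r_{n,k}=1$ and such that $w^r_{n,k}=a_{n-2k}$ for all $k$ in the coarse grid whenever every $k\in\mathbb Z^s$ with $a_{n-2k}\ne0$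 lies in the coarse grid (so that periodization, reflection, and tailored boundary rules are all allowed). Put $\mathrm S\tilde u_{n,r-1}=\mathrm{mean}(w^r_{n,\cdot},\tilde u_{\cdot,r-1})$. **Details.** For $x,y\in\mathcal M$ let $y\ominus x=\exp_x^{-1}(y)$ be the set of all tangent vectors at $x$ that the Riemannian exponential map takes to $y$. For $1\le r\le R$ and $0\le n<2^rN'$ the set $d_{n,r}(u)$ consists of the tangent vectors of smallest Riemannian norm among all $2^{-sr/2}w$ with $w\in\tilde u_{n,r}\ominus\hat u$ and $\hat u\in\mathrm S\tilde u_{n,r-1}$; $\|d_{n,r}(u)\|$ denotes their common norm. **Functional.** Let $\alpha\in\mathbb R$, $q\ge1$, $p>0$, $\lambda=(\lambda_1,\lambda_2)$, and $$\mathcal W_\lambda^{\alpha,q}(u)=\lambda_1\sum_{r=1}^R\sum_{0\le n<2^rN'}2^{rq(\alpha+\frac s2-\frac sq)}\|d_{n,r}(u)\|^q+\lambda_2\sum_{n,i}\mathrm{dist}(\tilde u_{n-e_i,0},\tilde u_{n,0})^q,$$ where the last sum is over all $0\le n<N'$ and $1\le i\le s$ with $n_i\ge1$. Let $K$ be a finite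 index set, $f\in\mathcal M^K$ data, $A=(A_{i,j})$ a real matrix with rows indexed by $K$, columns indexed by the grid $0\le j<N$, and positive row sums $\sum_jA_{i,j}>0$ (entries may be negative). Let $\mathcal A$ be the imaging operator $\mathcal A(u)_i=\mathrm{mean}(A_{i,\cdot},u)$, and $\mathrm{dist}(\mathcal A(u),f)^p=\sum_{i\in K}\mathrm{dist}(\mathcal A(u)_i,f_i)^p$, where for a non-unique mean $\mathrm{dist}(\mathcal A(u)_i,f_i)$ is the distance of $f_i$ to the set $\mathcal A(u)_i$. **Theorem.** All sets $\mathcal A(u)_i$ and $d_{n,r}(u)$ are nonempty, and if $\lambda_1>0$ and $\lambda_2>0$, then the variational problem $$\operatorname*{argmin}_{u\in\mathcal M^N}\ \mathrm{dist}(\mathcal A(u),f)^p+\mathcal W_\lambda^{\alpha,q}(u)$$ has a minimizer. -/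

import Mathlib

open scoped Manifold ContDiff Bundle

namespace WaveletReg

noncomputable section

/-! ### Grids, sampling and subdivision schemes -/

/-- The `s`-dimensional index grid `0 ≤ n < 2 ^ r * N'` of level `r`. -/
abbrev Grid {s : ℕ} (N' : Fin s → ℕ) (r : ℕ) : Type :=
  (ν : Fin s) → Fin (2 ^ r * N' ν)

/-- The integer multi-index of a grid point. -/
def Grid.toInt {s : ℕ} {N' : Fin s → ℕ} {r : ℕ} (n : Grid N' r) : Fin s → ℤ :=
  fun ν => ((n ν : ℕ) : ℤ)

/-- The grid point `2 ^ (R - r) * n` of level `R` that belongs to the grid point `n` of level `r`. -/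
def Grid.refine {s : ℕ} {N' : Fin s → ℕ} {r R : ℕ} (h : r ≤ R) (n : Grid N' r) : Grid N' R :=
  fun ν => ⟨2 ^ (R - r) * (n ν : ℕ), by
    have h1 : 2 ^ R * N' ν = 2 ^ (R - r) * (2 ^ r * N' ν) := by
      rw [← mul_assoc, ← pow_add, Nat.sub_add_cancel h]
    rw [h1]
    exact Nat.mul_lt_mul_of_pos_left (n ν).isLt (by positivity)⟩

/-- The neighbour `n - e_i` of a grid point `n` (only used when `n i ≠ 0`). -/
def Grid.pred {s : ℕ} {N' : Fin s → ℕ} {r : ℕ} (n : Grid N' r) (i : Fin s) : Grid N' r :=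
  Function.update n i ⟨(n i : ℕ) - 1, lt_of_le_of_lt (Nat.sub_le _ _) (n i).isLt⟩

/-- Thinning out: `ũ_{n,r} = u_{2 ^ (R - r) n}`. -/
def sample {M : Type*} {s : ℕ} {N' : Fin s → ℕ} {r R : ℕ} (h : r ≤ R) (u : Grid N' R → M) :
    Grid N' r → M :=
  fun n => u (n.refine h)

/-- A finitely supported mask `a` on `ℤ^s` of a dyadic subdivision scheme
`(S p)_n = ∑ k, a (n - 2 k) p_k` which reproduces constants and is interpolatory. -/
structure InterpolatoryMask (s : ℕ) where
  /-- the coefficients of the mask -/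
  coeff : (Fin s → ℤ) →₀ ℝ
  /-- constants are reproduced: the coefficients of each of the `2 ^ s` convolution operators encoded
  in the mask sum up to one -/
  sum_eq_one : ∀ n : Fin s → ℤ, ∑ᶠ k : Fin s → ℤ, coeff (n - 2 • k) = 1
  /-- the convolution operator of the coarse grid is the identity -/
  interpolatory : ∀ i : Fin s → ℤ, coeff (2 • i) = if i = 0 then 1 else 0

/-- The scheme with mask `a` on the bounded grids, with a boundary treatment. The entry
`weight r n k` is the weight with which the value at the grid point `k` of level `r` enters the
prediction at the grid point `n` of level `r + 1`. Where the stencil of the mask does not leave the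
grid, the weights are those of the mask; near the boundary they may be any weights that reproduce
constants. Periodization and reflection of the data (where the weights of repeated data points add
up) are of this form, and so are tailored boundary rules such as one-sided polynomial fits. -/
structure SubdivisionScheme {s : ℕ} (a : InterpolatoryMask s) (N' : Fin s → ℕ) where
  /-- the weights of the averages -/
  weight : (r : ℕ) → Grid N' (r + 1) → Grid N' r → ℝ
  /-- constants are reproduced -/
  sum_eq_one : ∀ (r : ℕ) (n : Grid N' (r + 1)), ∑ k, weight r n k = 1
  /-- in the interior the weights are those of the mask -/
  interior : ∀ (r : ℕ) (n : Grid N' (r + 1)),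
    (∀ k : Fin s → ℤ, a.coeff (n.toInt - 2 • k) ≠ 0 → ∃ m : Grid N' r, m.toInt = k) →
      ∀ m : Grid N' r, weight r n m = a.coeff (n.toInt - 2 • m.toInt)

/-! ### Intrinsic means -/

/-- The intrinsic mean `argmin_v ∑ j, w j * dist(v, p j) ^ 2`, as the set of all minimizers. -/
def intrinsicMean {M : Type*} [MetricSpace M] {ι : Type*} [Fintype ι] (w : ι → ℝ) (p : ι → M) :
    Set M :=
  {v | ∀ x : M, ∑ j, w j * dist v (p j) ^ 2 ≤ ∑ j, w j * dist x (p j) ^ 2}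

/-- The set-valued geometric subdivision scheme `(S p)_n = mean(a_{n - 2 ·}, p)`. -/
def SubdivisionScheme.predict {M : Type*} [MetricSpace M] {s : ℕ} {a : InterpolatoryMask s}
    {N' : Fin s → ℕ} (S : SubdivisionScheme a N') {r : ℕ} (p : Grid N' r → M)
    (n : Grid N' (r + 1)) : Set M :=
  intrinsicMean (S.weight r n) p

/-- The set of values at `i` of the imaging operator `𝒜(u)_i = mean(A_{i,·}, u)`. -/
def imaging {M : Type*} [MetricSpace M] {κ ι : Type*} [Fintype ι] (A : Matrix κ ι ℝ) (u : ι → M)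
    (i : κ) : Set M :=
  intrinsicMean (A i) u

/-- The data term `dist(𝒜(u), f) ^ p = ∑ i, dist(𝒜(u)_i, f_i) ^ p`. If the mean `𝒜(u)_i` is not
unique, the mean nearest to `f_i` is taken. -/
def dataTerm {M : Type*} [MetricSpace M] {κ ι : Type*} [Fintype κ] [Fintype ι] (A : Matrix κ ι ℝ)
    (f : κ → M) (p : ℝ) (u : ι → M) : ℝ :=
  ∑ i, Metric.infDist (f i) (imaging A u i) ^ p

/-! ### Geodesics, the Riemannian exponential map and the details -/

/-- `γ` restricted to `[0, 1]` is a geodesic segment: a curve of constant speed `c` that is locally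
distance minimizing. -/
def IsGeodesicSegment {M : Type*} [MetricSpace M] (γ : ℝ → M) : Prop :=
  ∃ c : ℝ, 0 ≤ c ∧ ∀ t ∈ Set.Icc (0 : ℝ) 1, ∃ ε > 0,
    ∀ t₁ ∈ Set.Icc (0 : ℝ) 1, ∀ t₂ ∈ Set.Icc (0 : ℝ) 1, |t₁ - t| < ε → |t₂ - t| < ε →
      dist (γ t₁) (γ t₂) = c * |t₁ - t₂|

variable {E : Type*} [NormedAddCommGroup E] [NormedSpace ℝ E]
  {M : Type*} [MetricSpace M] [ChartedSpace E M]

/-- `IsExp ξ y` says that the Riemannian exponential map takes the tangent vector `ξ` to `y`: the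
geodesic that starts at the base point of `ξ` with initial velocity `ξ` is at `y` at time `1`. -/
def IsExp (ξ : TangentBundle 𝓘(ℝ, E) M) (y : M) : Prop :=
  ∃ (γ : ℝ → M) (v : TangentSpace 𝓘(ℝ, E) (γ 0)), IsGeodesicSegment γ ∧
    HasMFDerivWithinAt 𝓘(ℝ, ℝ) 𝓘(ℝ, E) γ (Set.Icc 0 1) 0 (ContinuousLinearMap.toSpanSingleton ℝ v) ∧
    ξ = ⟨γ 0, v⟩ ∧ γ 1 = y

/-- `y ⊖ x = exp_x⁻¹ y`, as the set of all tangent vectors at `x` that `exp_x` takes to `y`. -/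
def expInv (x y : M) : Set (TangentSpace 𝓘(ℝ, E) x) :=
  {v | IsExp (⟨x, v⟩ : TangentBundle 𝓘(ℝ, E) M) y}

variable {s : ℕ} {a : InterpolatoryMask s} {N' : Fin s → ℕ}

/-- All tangent vectors `2 ^ (- s r / 2) (ũ_{n,r} ⊖ û)` with `û ∈ (S ũ_{·,r-1})_n`; the level,
running through `1, …, R`, is written `r + 1` with `r : Fin R`. -/
def detailCandidates (S : SubdivisionScheme a N') {R : ℕ} (u : Grid N' R → M) (r : Fin R)
    (n : Grid N' ((r : ℕ) + 1)) : Set (TangentBundle 𝓘(ℝ, E) M) :=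
  {d | ∃ û ∈ S.predict (sample r.isLt.le u) n,
    ∃ w ∈ expInv (E := E) û (sample (Nat.succ_le_of_lt r.isLt) u n),
      d = ⟨û, ((2 : ℝ) ^ (-((s : ℝ) * ((r : ℕ) + 1 : ℝ)) / 2)) • w⟩}

variable [Bundle.RiemannianBundle (fun x : M => TangentSpace 𝓘(ℝ, E) x)]

/-- The details `d_{n,r}(u)`: the candidates of smallest Riemannian norm. -/
def details (S : SubdivisionScheme a N') {R : ℕ} (u : Grid N' R → M) (r : Fin R)
    (n : Grid N' ((r : ℕ) + 1)) : Set (TangentBundle 𝓘(ℝ, E) M) :=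
  {d | d ∈ detailCandidates (E := E) S u r n ∧
    ∀ d' ∈ detailCandidates (E := E) S u r n, ‖d.2‖ ≤ ‖d'.2‖}

variable (E) in
/-- The norm `‖d_{n,r}(u)‖`, the common norm of all elements of `details S u r n`. -/
def detailNorm (S : SubdivisionScheme a N') {R : ℕ} (u : Grid N' R → M) (r : Fin R)
    (n : Grid N' ((r : ℕ) + 1)) : ℝ :=
  sInf ((fun d : TangentBundle 𝓘(ℝ, E) M => ‖d.2‖) '' details (E := E) S u r n)

variable (E) in
/-- The wavelet regularizer `𝒲_λ^{α,q}`, with `λ = (l₁, l₂)`. -/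
def waveletReg (S : SubdivisionScheme a N') (α q l₁ l₂ : ℝ) {R : ℕ} (u : Grid N' R → M) : ℝ :=
  l₁ * ∑ r : Fin R, ∑ n : Grid N' ((r : ℕ) + 1),
      (2 : ℝ) ^ (((r : ℕ) + 1 : ℝ) * q * (α + s / 2 - s / q)) * detailNorm E S u r n ^ q +
    l₂ * ∑ n : Grid N' 0, ∑ i : Fin s,
      if (n i : ℕ) ≠ 0 then
        dist (sample (Nat.zero_le R) u (n.pred i)) (sample (Nat.zero_le R) u n) ^ q
      else 0

end

end WaveletReg

/-!
The functional is minimized by the direct method, once it is expressed in terms of the metric of `M`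
alone.

Completeness makes `M` proper (Hopf–Rinow–Cohn-Vossen, `HasApproxGeodesics.properSpace`), and any
two points are joined by a curve that realizes their distance
(`HasApproxGeodesics.exists_geodesic`). To see that such a curve has an initial velocity, so that
it defines an element of `y ⊖ x`, no geodesic equation is needed. In the chart at `x` the
Riemannian distance agrees in a ball of radius `r` around `x` up to `O(r ^ 2)` with the distance of
the inner product space `T_x M` (`exists_abs_dist_sub_norm_le`), because the metric is
differentiable. Hence chords of a geodesic starting at `x` have almost the length of chords of a
straight line, the parallelogram law makes the difference quotients Cauchy
(`exists_tendsto_inv_smul`), and the norm of the velocity is the speed. Conversely a geodesic of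
speed `c` cannot have its endpoints further apart than `c`. So the shortest vectors in `y ⊖ x` have
norm `dist x y`, and the norm of a detail is a multiple of the distance from the data point to the
set of predictions (`details_nonempty_and_detailNorm_eq`).

Since the weights of a mean have a positive sum, means exist and stay at a distance from a point
`z` that is bounded linearly in the distance of the data from `z` (`dist_le_of_mem_intrinsicMean`).
This gives the lower semicontinuity of the distance to a set of means, hence of the functional, and
also its coercivity: the coarse differences and the details bound the diameter of a signal
(`exists_dist_le_of_predictionReg_le`), and the data term bounds its distance to the data.
-/

namespace WaveletReg

open Filter Topology Set

/-! ### Intrinsic means in proper metric spaces -/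

section Means

variable {M : Type*} [MetricSpace M] {ι : Type*} [Fintype ι]

/-- Points at which the weighted sum of squared distances is not larger than at `z` are close to
`z`, since the sum of the weights is positive. The bound is linear in the radius of the data. -/
theorem dist_le_of_sum_mul_dist_sq_le {w : ι → ℝ} (hw : 0 < ∑ j, w j) {p : ι → M} {z x : M} {D : ℝ}
    (hD : 0 ≤ D) (hp : ∀ j, dist z (p j) ≤ D)
    (h : ∑ j, w j * dist x (p j) ^ 2 ≤ ∑ j, w j * dist z (p j) ^ 2) :
    dist z x ≤ (1 + 4 * (∑ j, |w j|) / ∑ j, w j) * D := by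
  set W := ∑ j, w j
  set T := ∑ j, |w j|
  set t := dist z x with ht
  have hT : 0 ≤ T := Finset.sum_nonneg fun j _ => abs_nonneg _
  have ht0 : 0 ≤ t := dist_nonneg
  -- the triangle inequality gives `dist x (p j) ^ 2 = t ^ 2 + O(t * D + D ^ 2)`; the errors add up
  -- with the absolute values of the weights, which may be negative
  have h1 : W * t ^ 2 - T * (2 * t * D + D ^ 2) ≤ ∑ j, w j * dist x (p j) ^ 2 := by
    simp only [W, T, Finset.sum_mul, ← Finset.sum_sub_distrib]
    refine Finset.sum_le_sum fun j _ => ?_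
    have e1 : dist x (p j) ≤ t + D := by
      have := dist_triangle x z (p j)
      rw [dist_comm x z] at this
      linarith [hp j]
    have e2 : t ≤ dist x (p j) + D := by
      have := dist_triangle z (p j) x
      rw [dist_comm (p j) x] at this
      linarith [hp j]
    have e3 : |dist x (p j) ^ 2 - t ^ 2| ≤ 2 * t * D + D ^ 2 := by
      have := dist_nonneg (x := x) (y := p j)
      rw [abs_le]
      constructor
      · rcases le_total t D with h | h <;> nlinarith
      · nlinarith
    have e4 : |w j * (dist x (p j) ^ 2 - t ^ 2)| ≤ |w j| * (2 * t * D + D ^ 2) := by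
      rw [abs_mul]
      exact mul_le_mul_of_nonneg_left e3 (abs_nonneg _)
    have := neg_le_of_abs_le e4
    linarith
  have h2 : ∑ j, w j * dist z (p j) ^ 2 ≤ T * D ^ 2 := by
    simp only [T, Finset.sum_mul]
    refine Finset.sum_le_sum fun j _ => ?_
    have := hp j
    have h0 := dist_nonneg (x := z) (y := p j)
    calc w j * dist z (p j) ^ 2 ≤ |w j| * dist z (p j) ^ 2 := by
          gcongr
          exact le_abs_self _
      _ ≤ |w j| * D ^ 2 := by gcongr
  have h3 : W * t ^ 2 ≤ T * (2 * t * D + 2 * D ^ 2) := by linarith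
  have hTW : 0 ≤ 4 * T / W := by positivity
  rcases le_total t D with h | h
  · nlinarith [mul_nonneg hTW hD]
  · rcases ht0.eq_or_lt with h0 | h0
    · rw [← h0]; positivity
    have h4 : W * t ^ 2 ≤ 4 * T * D * t := by
      nlinarith [mul_nonneg (mul_nonneg hT hD) (sub_nonneg.2 h)]
    have h5 : W * t ≤ 4 * T * D := by
      by_contra! hc
      nlinarith [mul_lt_mul_of_pos_right hc h0]
    have h6 : t ≤ 4 * T / W * D := by
      rw [div_mul_eq_mul_div, le_div_iff₀ hw]
      linarith
    linarith

theorem dist_le_of_mem_intrinsicMean {w : ι → ℝ} (hw : 0 < ∑ j, w j) {p : ι → M} {z x : M} {D : ℝ}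
    (hD : 0 ≤ D) (hp : ∀ j, dist z (p j) ≤ D) (h : x ∈ intrinsicMean w p) :
    dist z x ≤ (1 + 4 * (∑ j, |w j|) / ∑ j, w j) * D :=
  dist_le_of_sum_mul_dist_sq_le hw hD hp (h z)

theorem intrinsicMean_nonempty [ProperSpace M] [Nonempty M] {w : ι → ℝ} (hw : 0 < ∑ j, w j)
    (p : ι → M) : (intrinsicMean w p).Nonempty := by
  obtain ⟨z⟩ := ‹Nonempty M›
  set D := ∑ j, dist z (p j)
  have hD : 0 ≤ D := Finset.sum_nonneg fun j _ => dist_nonneg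
  have hp : ∀ j, dist z (p j) ≤ D := fun j =>
    Finset.single_le_sum (f := fun j => dist z (p j)) (fun j _ => dist_nonneg) (Finset.mem_univ j)
  set B := (1 + 4 * (∑ j, |w j|) / ∑ j, w j) * D
  have hB : 0 ≤ B := by
    have : 0 ≤ ∑ j, |w j| := Finset.sum_nonneg fun j _ => abs_nonneg _
    positivity
  obtain ⟨v, hv, hmin⟩ := (isCompact_closedBall z B).exists_isMinOn
    (f := fun v => ∑ j, w j * dist v (p j) ^ 2) ⟨z, Metric.mem_closedBall_self hB⟩
    (by fun_prop)
  refine ⟨v, fun x => ?_⟩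
  by_cases hx : x ∈ Metric.closedBall z B
  · exact hmin hx
  · refine (hmin (Metric.mem_closedBall_self hB)).trans ?_
    by_contra! hc
    exact hx (by
      rw [Metric.mem_closedBall, dist_comm]
      exact dist_le_of_sum_mul_dist_sq_le hw hD hp hc.le)

theorem isClosed_intrinsicMean (w : ι → ℝ) (p : ι → M) : IsClosed (intrinsicMean w p) := by
  have : intrinsicMean w p =
      ⋂ x : M, {v | ∑ j, w j * dist v (p j) ^ 2 ≤ ∑ j, w j * dist x (p j) ^ 2} := by
    ext v; simp [intrinsicMean]
  rw [this]
  exact isClosed_iInter fun x => isClosed_le (by fun_prop) continuous_const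

theorem exists_mem_intrinsicMean_infDist_eq [ProperSpace M] {w : ι → ℝ} (hw : 0 < ∑ j, w j)
    (p : ι → M) (y : M) :
    ∃ v ∈ intrinsicMean w p, Metric.infDist y (intrinsicMean w p) = dist y v :=
  have : Nonempty M := ⟨y⟩
  (isClosed_intrinsicMean w p).exists_infDist_eq_dist (intrinsicMean_nonempty hw p) y

theorem intrinsicMean_const {w : ι → ℝ} (hw : 0 < ∑ j, w j) (c : M) :
    intrinsicMean w (fun _ => c) = {c} := by
  ext v
  simp only [intrinsicMean, mem_ofPred_eq, mem_singleton_iff, ← Finset.sum_mul]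
  constructor
  · intro h
    have h1 := h c
    simp only [dist_self, ne_eq, OfNat.ofNat_ne_zero, not_false_eq_true, zero_pow, mul_zero] at h1
    have h2 : dist v c ^ 2 ≤ 0 := by
      by_contra! hc
      exact absurd h1 (not_le.2 (mul_pos hw hc))
    exact dist_eq_zero.1 (pow_eq_zero_iff two_ne_zero |>.1 (le_antisymm h2 (sq_nonneg _)))
  · rintro rfl x
    simp only [dist_self, ne_eq, OfNat.ofNat_ne_zero, not_false_eq_true, zero_pow, mul_zero]
    positivity

/-- The distance to the set of means is lower semicontinuous in the data: means of convergent data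
stay in a bounded set, and their limits are means of the limit. -/
theorem lowerSemicontinuous_infDist_intrinsicMean [ProperSpace M] {w : ι → ℝ}
    (hw : 0 < ∑ j, w j) :
    LowerSemicontinuous fun x : (ι → M) × M => Metric.infDist x.2 (intrinsicMean w x.1) := by
  rw [lowerSemicontinuous_iff_isClosed_preimage]
  intro b
  refine IsSeqClosed.isClosed ?_
  intro x x₀ hx hlim
  have hlim1 : Tendsto (fun k => (x k).1) atTop (𝓝 x₀.1) := (continuous_fst.tendsto _).comp hlim
  have hlim2 : Tendsto (fun k => (x k).2) atTop (𝓝 x₀.2) := (continuous_snd.tendsto _).comp hlim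
  choose v hv hd using fun k => exists_mem_intrinsicMean_infDist_eq hw (x k).1 (x k).2
  have hvb : ∀ k, dist (x k).2 (v k) ≤ b := fun k => (hd k).symm.trans_le (hx k)
  obtain ⟨ρ, hρ⟩ := (Metric.isBounded_range_of_tendsto _ hlim2).subset_closedBall x₀.2
  obtain ⟨v₀, -, φ, hφ, hv₀⟩ := tendsto_subseq_of_bounded
    (Metric.isBounded_closedBall (x := x₀.2) (r := ρ + b)) (x := v) (fun k => by
      have h1 : dist (x k).2 x₀.2 ≤ ρ := hρ (mem_range_self k)
      have h2 := dist_triangle (v k) (x k).2 x₀.2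
      rw [dist_comm (v k) (x k).2] at h2
      exact Metric.mem_closedBall.2 (by linarith [hvb k]))
  have hmem : v₀ ∈ intrinsicMean w x₀.1 := by
    intro y
    have h1 : Tendsto (fun k => ((v ∘ φ) k, (x (φ k)).1)) atTop (𝓝 (v₀, x₀.1)) :=
      hv₀.prodMk_nhds (hlim1.comp hφ.tendsto_atTop)
    have c1 : Continuous fun a : M × (ι → M) => ∑ j, w j * dist a.1 (a.2 j) ^ 2 := by fun_prop
    have c2 : Continuous fun a : ι → M => ∑ j, w j * dist y (a j) ^ 2 := by fun_prop
    exact le_of_tendsto_of_tendsto' ((c1.tendsto _).comp h1)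
      ((c2.tendsto _).comp (hlim1.comp hφ.tendsto_atTop)) fun k => hv (φ k) y
  have hdist : dist x₀.2 v₀ ≤ b :=
    le_of_tendsto' ((hlim2.comp hφ.tendsto_atTop).dist hv₀) fun k => hvb (φ k)
  exact (Metric.infDist_le_dist_of_mem hmem).trans hdist

end Means

/-! ### The functional in metric terms -/

section Functional

variable {M : Type*} [MetricSpace M] {s : ℕ} {a : InterpolatoryMask s} {N' : Fin s → ℕ}

/-- The wavelet regularizer with the norm of the detail at level `r` replaced by a multiple `c r`
of the distance between data point and prediction, and general weights `b r`. -/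
noncomputable def predictionReg (S : SubdivisionScheme a N') {R : ℕ} (b c : Fin R → ℝ)
    (q l₁ l₂ : ℝ) (u : Grid N' R → M) : ℝ :=
  l₁ * ∑ r : Fin R, ∑ n : Grid N' ((r : ℕ) + 1), b r *
      (c r * Metric.infDist (sample (Nat.succ_le_of_lt r.isLt) u n)
        (S.predict (sample r.isLt.le u) n)) ^ q +
    l₂ * ∑ n : Grid N' 0, ∑ i : Fin s,
      if (n i : ℕ) ≠ 0 then
        dist (sample (Nat.zero_le R) u (n.pred i)) (sample (Nat.zero_le R) u n) ^ q
      else 0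

theorem continuous_sample {r R : ℕ} (h : r ≤ R) :
    Continuous fun u : Grid N' R → M => sample h u :=
  continuous_pi fun n => continuous_apply (n.refine h)

omit [MetricSpace M] in
theorem sample_le_rfl {R : ℕ} (u : Grid N' R → M) : sample le_rfl u = u := by
  funext n
  simp only [sample]
  congr 1
  funext ν
  ext
  simp [Grid.refine]

theorem lowerSemicontinuous_mul_rpow {X : Type*} [TopologicalSpace X] {g : X → ℝ}
    (hg : LowerSemicontinuous g) (h0 : ∀ x, 0 ≤ g x) {b c p : ℝ} (hb : 0 ≤ b) (hc : 0 ≤ c)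
    (hp : 0 ≤ p) : LowerSemicontinuous fun x => b * (c * g x) ^ p := by
  -- `t ↦ (c * t) ^ p` is monotone only for `0 ≤ t`, hence the truncation
  have h1 : Continuous fun t : ℝ => b * (c * max t 0) ^ p :=
    continuous_const.mul (Continuous.rpow_const (by fun_prop) fun _ => Or.inr hp)
  have h2 : Monotone fun t : ℝ => b * (c * max t 0) ^ p := by
    intro t t' h
    dsimp only
    have : 0 ≤ max t 0 := le_max_right _ _
    gcongr
  have h3 : (fun x => b * (c * g x) ^ p) = (fun t : ℝ => b * (c * max t 0) ^ p) ∘ g := by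
    funext x
    simp [max_eq_left (h0 x)]
  rw [h3]
  exact h1.comp_lowerSemicontinuous hg h2

theorem lowerSemicontinuous_dataTerm [ProperSpace M] {κ ι : Type*} [Fintype κ] [Fintype ι]
    (A : Matrix κ ι ℝ) (hA : ∀ i, 0 < ∑ j, A i j) (f : κ → M) {p : ℝ} (hp : 0 ≤ p) :
    LowerSemicontinuous fun u : ι → M => dataTerm A f p u := by
  refine lowerSemicontinuous_sum fun i _ => ?_
  have h1 : LowerSemicontinuous fun u : ι → M => Metric.infDist (f i) (imaging A u i) :=
    LowerSemicontinuous.comp (lowerSemicontinuous_infDist_intrinsicMean (M := M) (hA i))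
      (g := fun u : ι → M => (u, f i)) (by fun_prop)
  have := lowerSemicontinuous_mul_rpow h1 (fun _ => Metric.infDist_nonneg) zero_le_one zero_le_one
    hp
  simpa using this

theorem SubdivisionScheme.sum_weight_pos (S : SubdivisionScheme a N') (r : ℕ)
    (n : Grid N' (r + 1)) : 0 < ∑ k, S.weight r n k := by
  rw [S.sum_eq_one]; exact one_pos

theorem lowerSemicontinuous_predictionReg [ProperSpace M] (S : SubdivisionScheme a N') {R : ℕ}
    {b c : Fin R → ℝ} (hb : ∀ r, 0 ≤ b r) (hc : ∀ r, 0 ≤ c r) {q l₁ l₂ : ℝ} (hq : 0 ≤ q)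
    (hl₁ : 0 ≤ l₁) :
    LowerSemicontinuous fun u : Grid N' R → M => predictionReg S b c q l₁ l₂ u := by
  refine LowerSemicontinuous.add ?_ (Continuous.lowerSemicontinuous ?_)
  · have h1 : LowerSemicontinuous fun u : Grid N' R → M =>
        ∑ r : Fin R, ∑ n : Grid N' ((r : ℕ) + 1), b r *
          (c r * Metric.infDist (sample (Nat.succ_le_of_lt r.isLt) u n)
            (S.predict (sample r.isLt.le u) n)) ^ q := by
      refine lowerSemicontinuous_sum fun r _ => lowerSemicontinuous_sum fun n _ => ?_
      refine lowerSemicontinuous_mul_rpow ?_ (fun _ => Metric.infDist_nonneg) (hb r) (hc r) hq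
      exact LowerSemicontinuous.comp (lowerSemicontinuous_infDist_intrinsicMean (M := M)
        (S.sum_weight_pos r n))
        (g := fun u : Grid N' R → M => (sample r.isLt.le u,
          sample (Nat.succ_le_of_lt r.isLt) u n))
        ((continuous_sample _).prodMk ((continuous_apply n).comp (continuous_sample _)))
    exact (continuous_const.mul continuous_id).comp_lowerSemicontinuous h1
      fun _ _ h => mul_le_mul_of_nonneg_left h hl₁
  · refine continuous_const.mul
      (continuous_finsetSum _ fun n _ => continuous_finsetSum _ fun i _ => ?_)
    split_ifs
    · refine Continuous.rpow_const ?_ fun _ => Or.inr hq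
      exact (continuous_apply _).dist (continuous_apply _)
    · exact continuous_const

theorem dataTerm_nonneg {κ ι : Type*} [Fintype κ] [Fintype ι] (A : Matrix κ ι ℝ) (f : κ → M)
    (p : ℝ) (u : ι → M) : 0 ≤ dataTerm A f p u :=
  Finset.sum_nonneg fun _ _ => Real.rpow_nonneg Metric.infDist_nonneg _

theorem predictionReg_nonneg (S : SubdivisionScheme a N') {R : ℕ} {b c : Fin R → ℝ}
    (hb : ∀ r, 0 ≤ b r) (hc : ∀ r, 0 ≤ c r) {q l₁ l₂ : ℝ} (hl₁ : 0 ≤ l₁) (hl₂ : 0 ≤ l₂)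
    (u : Grid N' R → M) : 0 ≤ predictionReg S b c q l₁ l₂ u := by
  have h1 : ∀ (r : Fin R) (n : Grid N' ((r : ℕ) + 1)), 0 ≤ b r *
      (c r * Metric.infDist (sample (Nat.succ_le_of_lt r.isLt) u n)
        (S.predict (sample r.isLt.le u) n)) ^ q := fun r n =>
    mul_nonneg (hb r) (Real.rpow_nonneg (mul_nonneg (hc r) Metric.infDist_nonneg) _)
  refine add_nonneg (mul_nonneg hl₁ (Finset.sum_nonneg fun r _ => Finset.sum_nonneg fun n _ =>
    h1 r n)) (mul_nonneg hl₂ (Finset.sum_nonneg fun n _ => Finset.sum_nonneg fun i _ => ?_))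
  split_ifs
  · exact Real.rpow_nonneg dist_nonneg _
  · exact le_rfl

theorem infDist_imaging_le {κ ι : Type*} [Fintype κ] [Fintype ι] (A : Matrix κ ι ℝ) (f : κ → M)
    {p : ℝ} (hp : 0 < p) {u : ι → M} {C : ℝ} (h : dataTerm A f p u ≤ C) (i : κ) :
    Metric.infDist (f i) (imaging A u i) ≤ C ^ p⁻¹ := by
  have h1 : Metric.infDist (f i) (imaging A u i) ^ p ≤ C :=
    (Finset.single_le_sum (f := fun i => Metric.infDist (f i) (imaging A u i) ^ p)
      (fun _ _ => Real.rpow_nonneg Metric.infDist_nonneg _) (Finset.mem_univ i)).trans h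
  have h0 : 0 ≤ C := (Real.rpow_nonneg Metric.infDist_nonneg _).trans h1
  exact (Real.le_rpow_inv_iff_of_pos Metric.infDist_nonneg h0 hp).2 h1

theorem dist_pred_le (S : SubdivisionScheme a N') {R : ℕ} {b c : Fin R → ℝ}
    (hb : ∀ r, 0 < b r) (hc : ∀ r, 0 < c r) {q l₁ l₂ : ℝ} (hq : 0 < q) (hl₁ : 0 < l₁)
    (hl₂ : 0 < l₂) {u : Grid N' R → M} {C : ℝ} (h : predictionReg S b c q l₁ l₂ u ≤ C)
    (n : Grid N' 0) (i : Fin s) (hn : (n i : ℕ) ≠ 0) :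
    dist (sample (Nat.zero_le R) u (n.pred i)) (sample (Nat.zero_le R) u n) ≤ (C / l₂) ^ q⁻¹ := by
  have h1 : 0 ≤ l₁ * ∑ r : Fin R, ∑ n : Grid N' ((r : ℕ) + 1), b r *
      (c r * Metric.infDist (sample (Nat.succ_le_of_lt r.isLt) u n)
        (S.predict (sample r.isLt.le u) n)) ^ q :=
    mul_nonneg hl₁.le (Finset.sum_nonneg fun r _ => Finset.sum_nonneg fun n _ =>
      mul_nonneg (hb r).le (Real.rpow_nonneg (mul_nonneg (hc r).le Metric.infDist_nonneg) _))
  set F : Grid N' 0 → Fin s → ℝ := fun n i => if (n i : ℕ) ≠ 0 then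
        dist (sample (Nat.zero_le R) u (n.pred i)) (sample (Nat.zero_le R) u n) ^ q
      else 0 with hF
  have hF0 : ∀ n i, 0 ≤ F n i := fun n i => by
    simp only [hF]
    split_ifs
    · exact Real.rpow_nonneg dist_nonneg _
    · exact le_rfl
  have h2 : F n i ≤ ∑ n, ∑ i, F n i :=
    (Finset.single_le_sum (fun i _ => hF0 n i) (Finset.mem_univ i)).trans
      (Finset.single_le_sum (f := fun n => ∑ i, F n i)
        (fun n _ => Finset.sum_nonneg fun i _ => hF0 n i) (Finset.mem_univ n))
  have h3 : l₂ * ∑ n, ∑ i, F n i ≤ C := (le_add_of_nonneg_left h1).trans h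
  have h4 : F n i ≤ C / l₂ := h2.trans ((le_div_iff₀' hl₂).2 h3)
  simp only [hF, if_pos hn] at h4
  exact (Real.le_rpow_inv_iff_of_pos dist_nonneg
    ((Real.rpow_nonneg dist_nonneg _).trans h4) hq).2 h4

theorem infDist_predict_le (S : SubdivisionScheme a N') {R : ℕ} {b c : Fin R → ℝ}
    (hb : ∀ r, 0 < b r) (hc : ∀ r, 0 < c r) {q l₁ l₂ : ℝ} (hq : 0 < q) (hl₁ : 0 < l₁)
    (hl₂ : 0 < l₂) {u : Grid N' R → M} {C : ℝ} (h : predictionReg S b c q l₁ l₂ u ≤ C)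
    (r : Fin R) (n : Grid N' ((r : ℕ) + 1)) :
    Metric.infDist (sample (Nat.succ_le_of_lt r.isLt) u n) (S.predict (sample r.isLt.le u) n) ≤
      (C / l₁ / b r) ^ q⁻¹ / c r := by
  set F : (r : Fin R) → Grid N' ((r : ℕ) + 1) → ℝ := fun r n => b r *
      (c r * Metric.infDist (sample (Nat.succ_le_of_lt r.isLt) u n)
        (S.predict (sample r.isLt.le u) n)) ^ q with hF
  have hF0 : ∀ r n, 0 ≤ F r n := fun r n =>
    mul_nonneg (hb r).le (Real.rpow_nonneg (mul_nonneg (hc r).le Metric.infDist_nonneg) _)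
  have h2 : F r n ≤ ∑ r, ∑ n, F r n :=
    (Finset.single_le_sum (fun n _ => hF0 r n) (Finset.mem_univ n)).trans
      (Finset.single_le_sum (f := fun r => ∑ n, F r n)
        (fun r _ => Finset.sum_nonneg fun n _ => hF0 r n) (Finset.mem_univ r))
  have h1 : 0 ≤ l₂ * ∑ n : Grid N' 0, ∑ i : Fin s, if (n i : ℕ) ≠ 0 then
        dist (sample (Nat.zero_le R) u (n.pred i)) (sample (Nat.zero_le R) u n) ^ q
      else 0 := by
    refine mul_nonneg hl₂.le (Finset.sum_nonneg fun n _ => Finset.sum_nonneg fun i _ => ?_)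
    split_ifs
    · exact Real.rpow_nonneg dist_nonneg _
    · exact le_rfl
  have h3 : l₁ * ∑ r, ∑ n, F r n ≤ C := (le_add_of_nonneg_right h1).trans h
  have h4 : F r n ≤ C / l₁ := h2.trans ((le_div_iff₀' hl₁).2 h3)
  have h5 := (le_div_iff₀' (hb r)).2 h4
  have h6 := (Real.le_rpow_inv_iff_of_pos (mul_nonneg (hc r).le Metric.infDist_nonneg)
    ((Real.rpow_nonneg (mul_nonneg (hc r).le Metric.infDist_nonneg) _).trans h5) hq).2 h5
  exact (le_div_iff₀' (hc r)).2 h6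

/-- If the values at neighbouring points of a grid are at most `b` apart, then a value is within
`b` times the `ℓ¹`-distance of the grid points from the value at the origin. -/
theorem dist_zero_le_of_dist_pred_le {g : Grid N' 0 → M} {b : ℝ} (hb : 0 ≤ b)
    (h : ∀ (n : Grid N' 0) (i : Fin s), (n i : ℕ) ≠ 0 → dist (g (n.pred i)) (g n) ≤ b)
    (z : Grid N' 0) (hz : ∀ i, (z i : ℕ) = 0) (n : Grid N' 0) :
    dist (g z) (g n) ≤ (∑ i, (N' i : ℝ)) * b := by
  have key : ∀ (k : ℕ) (n : Grid N' 0), ∑ i, (n i : ℕ) = k → dist (g z) (g n) ≤ k * b := by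
    intro k
    induction k with
    | zero =>
      intro n hn
      have : n = z := by
        funext i
        ext
        rw [hz i]
        exact (Finset.sum_eq_zero_iff.1 hn) i (Finset.mem_univ i)
      simp [this]
    | succ k ih =>
      intro n hn
      obtain ⟨i, -, hi⟩ : ∃ i ∈ Finset.univ, (n i : ℕ) ≠ 0 := by
        by_contra! hc
        have := Finset.sum_eq_zero hc
        omega
      have h1 : ∑ j, ((n.pred i) j : ℕ) = k := by
        have e1 := Finset.add_sum_erase Finset.univ (fun j => (n j : ℕ)) (Finset.mem_univ i)
        have e2 := Finset.add_sum_erase Finset.univ (fun j => ((n.pred i) j : ℕ))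
          (Finset.mem_univ i)
        have e3 : ∑ j ∈ Finset.univ.erase i, ((n.pred i) j : ℕ) =
            ∑ j ∈ Finset.univ.erase i, (n j : ℕ) := by
          refine Finset.sum_congr rfl fun j hj => ?_
          simp [Grid.pred, Function.update_of_ne (Finset.ne_of_mem_erase hj)]
        have e4 : ((n.pred i) i : ℕ) = n i - 1 := by simp [Grid.pred]
        omega
      have h2 := ih _ h1
      have h3 := dist_triangle (g z) (g (n.pred i)) (g n)
      push_cast
      linarith [h n i hi]
  refine (key _ n rfl).trans ?_
  gcongr
  push_cast
  refine Finset.sum_le_sum fun i _ => ?_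
  have := (n i).isLt
  simp only [pow_zero, one_mul] at this
  exact_mod_cast this.le

/-- A bound of the regularizer bounds the diameter of the signal: the coarsest values are chained
together by the second term, and each finer value is controlled by its detail and by the prediction
from the coarser values. -/
theorem exists_dist_le_of_predictionReg_le [ProperSpace M] (S : SubdivisionScheme a N') {R : ℕ}
    {b c : Fin R → ℝ} (hb : ∀ r, 0 < b r) (hc : ∀ r, 0 < c r) {q l₁ l₂ : ℝ} (hq : 0 < q)
    (hl₁ : 0 < l₁) (hl₂ : 0 < l₂) (z : Grid N' 0) (hz : ∀ i, (z i : ℕ) = 0) {C : ℝ} (hC : 0 ≤ C) :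
    ∃ B, 0 ≤ B ∧ ∀ u : Grid N' R → M, predictionReg S b c q l₁ l₂ u ≤ C →
      ∀ n, dist (sample (Nat.zero_le R) u z) (u n) ≤ B := by
  have key : ∀ (r : ℕ) (hr : r ≤ R), ∃ B, 0 ≤ B ∧ ∀ u : Grid N' R → M,
      predictionReg S b c q l₁ l₂ u ≤ C →
      ∀ n, dist (sample (Nat.zero_le R) u z) (sample hr u n) ≤ B := by
    intro r
    induction r with
    | zero =>
      intro hr
      refine ⟨(∑ i, (N' i : ℝ)) * (C / l₂) ^ q⁻¹, by positivity, fun u hu n => ?_⟩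
      exact dist_zero_le_of_dist_pred_le (by positivity)
        (fun n i hn => dist_pred_le S hb hc hq hl₁ hl₂ hu n i hn) z hz n
    | succ r ih =>
      intro hr
      obtain ⟨B, hB, h⟩ := ih (Nat.le_of_succ_le hr)
      set K : Grid N' (r + 1) → ℝ := fun n =>
        (1 + 4 * (∑ j, |S.weight r n j|) / ∑ j, S.weight r n j) * B
      have hK : ∀ n, 0 ≤ K n := fun n => by
        have := (S.sum_weight_pos r n).le
        have : 0 ≤ ∑ j, |S.weight r n j| := Finset.sum_nonneg fun j _ => abs_nonneg _
        positivity
      set D := (C / l₁ / b ⟨r, hr⟩) ^ q⁻¹ / c ⟨r, hr⟩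
      have hD : 0 ≤ D := by
        have := (hb ⟨r, hr⟩).le
        have := (hc ⟨r, hr⟩).le
        positivity
      refine ⟨∑ n, K n + D, add_nonneg (Finset.sum_nonneg fun n _ => hK n) hD, fun u hu n => ?_⟩
      obtain ⟨v, hv, hd⟩ := exists_mem_intrinsicMean_infDist_eq (S.sum_weight_pos r n)
        (sample (Nat.le_of_succ_le hr) u) (sample hr u n)
      have h1 : dist (sample (Nat.zero_le R) u z) v ≤ K n :=
        dist_le_of_mem_intrinsicMean (S.sum_weight_pos r n) hB (h u hu) hv
      have h2 : dist (sample hr u n) v ≤ D :=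
        hd.symm.trans_le (infDist_predict_le S hb hc hq hl₁ hl₂ hu ⟨r, hr⟩ n)
      have h3 : K n ≤ ∑ n, K n := Finset.single_le_sum (fun n _ => hK n) (Finset.mem_univ n)
      have h4 := dist_triangle (sample (Nat.zero_le R) u z) v (sample hr u n)
      rw [dist_comm v] at h4
      linarith
  obtain ⟨B, hB, h⟩ := key R le_rfl
  refine ⟨B, hB, fun u hu n => ?_⟩
  have := h u hu n
  rwa [sample_le_rfl] at this

theorem predictionReg_const (S : SubdivisionScheme a N') {R : ℕ} {b c : Fin R → ℝ}
    {q l₁ l₂ : ℝ} (hq : 0 < q) (x : M) :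
    predictionReg S b c q l₁ l₂ (fun _ : Grid N' R => x) = 0 := by
  have h1 : ∀ (r : Fin R) (n : Grid N' ((r : ℕ) + 1)),
      S.predict (sample r.isLt.le (fun _ : Grid N' R => x)) n = {x} := fun r n =>
    intrinsicMean_const (S.sum_weight_pos r n) x
  simp [predictionReg, h1, sample, Real.zero_rpow hq.ne']

/-- The direct method: the functional is lower semicontinuous, and coercive as soon as there are
any data; without data, the constant signals are minimizers. -/
theorem exists_forall_dataTerm_add_predictionReg_le [ProperSpace M] [Nonempty M]
    (S : SubdivisionScheme a N') {R : ℕ} {b c : Fin R → ℝ} (hb : ∀ r, 0 < b r) (hc : ∀ r, 0 < c r)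
    {κ : Type*} [Fintype κ] (A : Matrix κ (Grid N' R) ℝ) (hA : ∀ i, 0 < ∑ j, A i j) (f : κ → M)
    {p q l₁ l₂ : ℝ} (hp : 0 < p) (hq : 0 < q) (hl₁ : 0 < l₁) (hl₂ : 0 < l₂) :
    ∃ u : Grid N' R → M, ∀ v : Grid N' R → M,
      dataTerm A f p u + predictionReg S b c q l₁ l₂ u ≤
        dataTerm A f p v + predictionReg S b c q l₁ l₂ v := by
  have hreg0 := predictionReg_nonneg (M := M) (q := q) S (fun r => (hb r).le) (fun r => (hc r).le)
    hl₁.le hl₂.le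
  rcases isEmpty_or_nonempty κ with hκ | ⟨⟨i⟩⟩
  · obtain ⟨x⟩ := ‹Nonempty M›
    refine ⟨fun _ => x, fun v => ?_⟩
    rw [predictionReg_const S hq]
    simpa [dataTerm] using hreg0 v
  obtain ⟨m⟩ : Nonempty (Grid N' R) := by
    by_contra hne
    rw [not_nonempty_iff] at hne
    simpa using hA i
  set z : Grid N' 0 := fun ν => ⟨0, by
    rcases Nat.eq_zero_or_pos (N' ν) with h | h
    · have := (m ν).isLt
      simp [h] at this
    · simpa using h⟩
  set J : (Grid N' R → M) → ℝ := fun u => dataTerm A f p u + predictionReg S b c q l₁ l₂ u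
  have hJ : LowerSemicontinuous J := (lowerSemicontinuous_dataTerm A hA f hp.le).add
    (lowerSemicontinuous_predictionReg S (fun r => (hb r).le) (fun r => (hc r).le) hq.le hl₁.le)
  set u₀ : Grid N' R → M := fun _ => f i
  set C := J u₀
  have hC : 0 ≤ C := add_nonneg (dataTerm_nonneg _ _ _ _) (hreg0 _)
  obtain ⟨B, hB, hBu⟩ := exists_dist_le_of_predictionReg_le (M := M) S hb hc hq hl₁ hl₂ z
    (fun _ => rfl) hC
  set B' := C ^ p⁻¹ + (1 + 4 * (∑ j, |A i j|) / ∑ j, A i j) * B + B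
  have hsub : ∀ u, J u ≤ C → ∀ n, dist (f i) (u n) ≤ B' := by
    intro u hu n
    have h1 := hBu u ((le_add_of_nonneg_left (dataTerm_nonneg _ _ _ _)).trans hu)
    have h2 := infDist_imaging_le A f hp ((le_add_of_nonneg_right (hreg0 u)).trans hu) i
    obtain ⟨v, hv, hd⟩ := exists_mem_intrinsicMean_infDist_eq (hA i) u (f i)
    have h3 := dist_le_of_mem_intrinsicMean (hA i) hB h1 hv
    have h4 : dist (f i) v ≤ C ^ p⁻¹ := hd.symm.trans_le h2
    have h5 := dist_triangle4 (f i) v (sample (Nat.zero_le R) u z) (u n)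
    rw [dist_comm v] at h5
    linarith [h1 n]
  have hcpt : IsCompact {u | J u ≤ C} := by
    refine IsCompact.of_isClosed_subset
      (isCompact_univ_pi fun _ : Grid N' R => isCompact_closedBall (f i) B')
      (hJ.isClosed_preimage C) fun u hu n _ => ?_
    rw [Metric.mem_closedBall, dist_comm]
    exact hsub u hu n
  obtain ⟨u, hu, hmin⟩ := hJ.lowerSemicontinuousOn _ |>.exists_isMinOn
    (s := {u | J u ≤ C}) ⟨u₀, le_refl C⟩ hcpt
  refine ⟨u, fun v => ?_⟩
  by_cases hv : J v ≤ C
  · exact hmin hv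
  · exact le_trans hu (not_le.1 hv).le

end Functional

/-! ### Curves with almost straight chords -/

section Velocity

variable {V : Type*} [NormedAddCommGroup V] [InnerProductSpace ℝ V]

/-- Difference quotients at comparable times `s ≤ t ≤ 2 s` are `O(√t)`-close. -/
theorem norm_inv_smul_sub_sq_le {h : ℝ → V} {c K δ : ℝ} (hc : 0 ≤ c) (hK : 0 ≤ K) (hδ : δ ≤ 1)
    (h0 : h 0 = 0)
    (H : ∀ t, 0 < t → t < δ → ∀ s ∈ Icc 0 t, ∀ s' ∈ Icc 0 t,
      |(‖h s - h s'‖ - c * |s - s'|)| ≤ K * t ^ 2) {s t : ℝ} (hs : 0 < s) (hst : s ≤ t)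
    (hts : t ≤ 2 * s) (ht : t < δ) :
    ‖s⁻¹ • h s - t⁻¹ • h t‖ ^ 2 ≤ 16 * (c + K + 1) ^ 2 * t := by
  have ht0 : 0 < t := hs.trans_le hst
  have ht1 : t ≤ 1 := ht.le.trans hδ
  have A : |‖h s‖ - c * s| ≤ K * s ^ 2 := by
    have := H s hs (hst.trans_lt ht) s ⟨hs.le, le_rfl⟩ 0 ⟨le_rfl, hs.le⟩
    simpa [h0, abs_of_pos hs] using this
  have B : |‖h t‖ - c * t| ≤ K * t ^ 2 := by
    have := H t ht0 ht t ⟨ht0.le, le_rfl⟩ 0 ⟨le_rfl, ht0.le⟩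
    simpa [h0, abs_of_pos ht0] using this
  have C : |‖h t - h s‖ - c * (t - s)| ≤ K * t ^ 2 := by
    have := H t ht0 ht t ⟨ht0.le, le_rfl⟩ s ⟨hs.le, hst⟩
    rwa [abs_of_nonneg (sub_nonneg.2 hst)] at this
  set d := ‖h t - h s‖ with hd
  have hd0 : 0 ≤ d := norm_nonneg _
  set α := ‖h s‖ / s
  set β := ‖h t‖ / t
  have ha : ‖h s‖ = s * α := by simp only [α]; field_simp
  have hb : ‖h t‖ = t * β := by simp only [β]; field_simp
  have hα0 : 0 ≤ α := by positivity
  rw [ha, show s * α - c * s = s * (α - c) by ring, abs_mul, abs_of_pos hs,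
    show K * s ^ 2 = s * (K * s) by ring] at A
  rw [hb, show t * β - c * t = t * (β - c) by ring, abs_mul, abs_of_pos ht0,
    show K * t ^ 2 = t * (K * t) by ring] at B
  have A' := le_of_mul_le_mul_left A hs
  have B' := le_of_mul_le_mul_left B ht0
  -- polarization expresses the distance of the difference quotients by the three chord lengths
  have e1 : s * t * ‖s⁻¹ • h s - t⁻¹ • h t‖ ^ 2 = (t - s) * (s * α ^ 2 - t * β ^ 2) + d ^ 2 := by
    rw [hd, norm_sub_sq_real (h t) (h s), norm_sub_sq_real, norm_smul, norm_smul, inner_smul_left,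
      inner_smul_right, real_inner_comm, ha, hb]
    simp only [norm_inv, Real.norm_eq_abs, abs_of_pos hs, abs_of_pos ht0, RCLike.conj_to_real]
    field_simp
    ring
  have hKt : 0 ≤ K * t := by positivity
  have hKst : K * s ≤ K * t := by gcongr
  have f1 : α ^ 2 ≤ (c + K * t) ^ 2 := by
    have := (abs_le.1 A').2
    gcongr
    linarith
  have f2 : c ^ 2 - 2 * c * (K * t) ≤ β ^ 2 := by
    nlinarith [(abs_le.1 B').1, sq_nonneg (β - c)]
  have f3 : d ^ 2 ≤ (c * (t - s) + K * t ^ 2) ^ 2 := by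
    have := (abs_le.1 C).2
    gcongr
    linarith
  have hts0 : 0 ≤ t - s := sub_nonneg.2 hst
  have g1 : (t - s) * (s * α ^ 2 - t * β ^ 2) ≤
      (t - s) * (s * (c + K * t) ^ 2 - t * (c ^ 2 - 2 * c * (K * t))) := by gcongr
  have g2 : s * t * ‖s⁻¹ • h s - t⁻¹ • h t‖ ^ 2 ≤
      (t - s) * t * (s * (2 * c * K + K ^ 2 * t) + 4 * c * K * t) + K ^ 2 * t ^ 4 := by
    rw [e1]
    refine (add_le_add g1 f3).trans (le_of_eq ?_)
    ring
  have g3 : (t - s) * t * (s * (2 * c * K + K ^ 2 * t) + 4 * c * K * t) + K ^ 2 * t ^ 4 ≤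
      (t / 2) * t * (t * (2 * c * K + K ^ 2 * 1) + 4 * c * K * t) + K ^ 2 * (t ^ 3 * 1) := by
    rw [show K ^ 2 * t ^ 4 = K ^ 2 * (t ^ 3 * t) by ring]
    gcongr
    linarith
  have g4 : t ^ 2 / 2 * ‖s⁻¹ • h s - t⁻¹ • h t‖ ^ 2 ≤ s * t * ‖s⁻¹ • h s - t⁻¹ • h t‖ ^ 2 := by
    gcongr
    nlinarith
  have g5 : t ^ 2 / 2 * ‖s⁻¹ • h s - t⁻¹ • h t‖ ^ 2 ≤
      t ^ 2 / 2 * (16 * (c + K + 1) ^ 2 * t) := by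
    refine (g4.trans (g2.trans g3)).trans ?_
    have : 0 ≤ t ^ 3 * (8 * c ^ 2 + 13 * c * K + 13 / 2 * K ^ 2 + 8 + 16 * c + 16 * K) := by
      positivity
    refine sub_nonneg.1 (this.trans_eq ?_)
    ring
  exact le_of_mul_le_mul_left g5 (by positivity)

/-- A curve through the origin whose chords have the length of those of a straight line of constant
speed `c`, up to a quadratic error, has a one-sided derivative at the origin. By the parallelogram
law, difference quotients at comparable times are `O(√t)`-close; these errors are summable along
dyadic times. -/
theorem exists_tendsto_inv_smul [CompleteSpace V] {h : ℝ → V} {c K δ : ℝ} (hc : 0 ≤ c) (hK : 0 ≤ K)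
    (hδ0 : 0 < δ) (h0 : h 0 = 0)
    (H : ∀ t, 0 < t → t < δ → ∀ s ∈ Icc 0 t, ∀ s' ∈ Icc 0 t,
      |(‖h s - h s'‖ - c * |s - s'|)| ≤ K * t ^ 2) :
    ∃ v : V, Tendsto (fun t => t⁻¹ • h t) (𝓝[>] 0) (𝓝 v) := by
  wlog hδ : δ ≤ 1 generalizing δ
  · exact this (δ := min δ 1) (by positivity)
      (fun t h1 h2 => H t h1 (h2.trans_le (min_le_left _ _))) (min_le_right _ _)
  set L := 4 * (c + K + 1) with hL
  have hL0 : 0 < L := by positivity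
  have step : ∀ s t, 0 < s → s ≤ t → t ≤ 2 * s → t < δ →
      ‖s⁻¹ • h s - t⁻¹ • h t‖ ≤ L * √t := by
    intro s t hs hst hts ht
    have h1 := norm_inv_smul_sub_sq_le hc hK hδ h0 H hs hst hts ht
    have ht0 : 0 ≤ t := hs.le.trans hst
    refine abs_le_of_sq_le_sq' ?_ (by positivity) |>.2
    rw [mul_pow, Real.sq_sqrt ht0]
    linarith [hL, show L ^ 2 * t = 16 * (c + K + 1) ^ 2 * t by rw [hL]; ring]
  -- the bound for dyadic steps is summed up: `√(t / 2) ≤ 3 / 4 * √t`, and `4 * (3 / 4) + 1 = 4`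
  have chain : ∀ (n : ℕ) (s t : ℝ), 0 < s → s ≤ t → t ≤ 2 ^ n * s → t < δ →
      ‖s⁻¹ • h s - t⁻¹ • h t‖ ≤ 4 * L * √t := by
    intro n
    induction n with
    | zero =>
      intro s t hs hst hts ht
      have h1 := step s t hs hst (by simp at hts; linarith) ht
      have : 0 ≤ L * √t := by positivity
      linarith
    | succ n ih =>
      intro s t hs hst hts ht
      have ht0 : 0 < t := hs.trans_le hst
      rcases le_total t (2 * s) with h2 | h2
      · have h1 := step s t hs hst h2 ht
        have : 0 ≤ L * √t := by positivity
        linarith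
      · have h3 := ih s (t / 2) hs (by linarith) (by rw [pow_succ] at hts; linarith) (by linarith)
        have h4 := step (t / 2) t (by linarith) (by linarith) (by linarith) ht
        have h5 := norm_sub_le_norm_sub_add_norm_sub (s⁻¹ • h s) ((t / 2)⁻¹ • h (t / 2)) (t⁻¹ • h t)
        have h6 : √(t / 2) ≤ 3 / 4 * √t := by
          rw [Real.sqrt_le_left (by positivity), mul_pow, Real.sq_sqrt ht0.le]
          linarith
        nlinarith
  have hcau : Cauchy (map (fun t => t⁻¹ • h t) (𝓝[>] (0 : ℝ))) := by
    rw [Metric.cauchy_iff]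
    refine ⟨inferInstance, fun ε hε => ?_⟩
    set η := min δ ((ε / (8 * L)) ^ 2) with hη
    have hη0 : 0 < η := by positivity
    refine ⟨(fun t => t⁻¹ • h t) '' Ioo 0 η, image_mem_map (Ioo_mem_nhdsGT hη0), ?_⟩
    have key : ∀ s t, 0 < s → s ≤ t → t < η → dist (s⁻¹ • h s) (t⁻¹ • h t) < ε := by
      intro s t hs hst ht
      obtain ⟨n, hn⟩ := pow_unbounded_of_one_lt (t / s) (one_lt_two)
      have h1 := chain n s t hs hst ((div_le_iff₀ hs).1 hn.le) (ht.trans_le (min_le_left _ _))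
      have h2 : √t < ε / (8 * L) := by
        rw [Real.sqrt_lt' (by positivity)]
        exact ht.trans_le (min_le_right _ _)
      rw [lt_div_iff₀ (by positivity)] at h2
      rw [dist_eq_norm]
      linarith
    rintro _ ⟨s, hs, rfl⟩ _ ⟨t, ht, rfl⟩
    rcases le_total s t with hst | hst
    · exact key s t hs.1 hst ht.2
    · rw [dist_comm]
      exact key t s ht.1 hst hs.2
  obtain ⟨v, hv⟩ := CompleteSpace.complete hcau
  exact ⟨v, hv⟩

/-- The velocity of a curve at time `0` has the speed of the curve as its norm. -/
theorem norm_eq_of_tendsto_inv_smul {h : ℝ → V} {c K δ : ℝ} (hδ : 0 < δ)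
    (H : ∀ t, 0 < t → t < δ → |‖h t‖ - c * t| ≤ K * t ^ 2) {v : V}
    (hv : Tendsto (fun t => t⁻¹ • h t) (𝓝[>] 0) (𝓝 v)) : ‖v‖ = c := by
  refine tendsto_nhds_unique hv.norm ?_
  rw [tendsto_iff_norm_sub_tendsto_zero]
  have h1 : Tendsto (fun t : ℝ => K * t) (𝓝[>] 0) (𝓝 0) := by
    have : Tendsto (fun t : ℝ => K * t) (𝓝 0) (𝓝 (K * 0)) := by
      exact (continuous_const.mul continuous_id).tendsto _
    rw [mul_zero] at this
    exact this.mono_left nhdsWithin_le_nhds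
  refine squeeze_zero' (Eventually.of_forall fun _ => norm_nonneg _) ?_ h1
  filter_upwards [Ioo_mem_nhdsGT hδ] with t ht
  have h2 := H t ht.1 ht.2
  rw [norm_smul, norm_inv, Real.norm_eq_abs, Real.norm_eq_abs, abs_of_pos ht.1]
  have h3 : t⁻¹ * ‖h t‖ - c = t⁻¹ * (‖h t‖ - c * t) := by
    have := ht.1.ne'
    field_simp
  rw [h3, abs_mul, abs_inv, abs_of_pos ht.1, inv_mul_le_iff₀ ht.1]
  linarith

end Velocity

/-! ### Length spaces and the Hopf–Rinow theorem -/

section LengthSpace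

variable {M : Type*} [MetricSpace M]

/-- Any two points are joined by curves that are minimizing geodesics up to an arbitrarily small
error. -/
def HasApproxGeodesics (M : Type*) [MetricSpace M] : Prop :=
  ∀ (x y : M) (ε : ℝ), 0 < ε → ∃ f : Icc (0 : ℝ) 1 → M, f 0 = x ∧ f 1 = y ∧
    ∀ s t, dist (f s) (f t) ≤ dist x y * |(s : ℝ) - t| + ε

/-- A continuous curve whose length exceeds the distance of its endpoints by little becomes an
approximate geodesic when it is reparametrized by the distance from its starting point. -/
theorem hasApproxGeodesics_of_exists_continuousOn
    (H : ∀ (x y : M) (ε : ℝ), 0 < ε → ∃ γ : ℝ → M, ContinuousOn γ (Icc 0 1) ∧ γ 0 = x ∧ γ 1 = y ∧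
      ∀ a b, 0 ≤ a → a ≤ b → b ≤ 1 →
        dist x (γ a) + dist (γ a) (γ b) + dist (γ b) y ≤ dist x y + ε) :
    HasApproxGeodesics M := by
  intro x y ε hε
  rcases eq_or_ne x y with rfl | hne
  · exact ⟨fun _ => x, rfl, rfl, fun s t => by simp [hε.le]⟩
  obtain ⟨γ, hγ, h0, h1, h⟩ := H x y ε hε
  set D := dist x y with hD
  have hD0 : 0 < D := dist_pos.2 hne
  -- the values at the endpoints are prescribed: `γ` may pass other points at distance `D` before `y`
  have hσ : ∀ t : Icc (0 : ℝ) 1, ∃ a ∈ Icc (0 : ℝ) 1, dist x (γ a) = t * D ∧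
      (t = 0 → a = 0) ∧ (t = 1 → a = 1) := by
    intro t
    by_cases ht0 : t = 0
    · exact ⟨0, by simp, by simp [ht0, h0], fun _ => rfl, fun h1 => by simp [ht0] at h1⟩
    by_cases ht1 : t = 1
    · exact ⟨1, by simp, by simp [ht1, h1, hD], fun h => absurd h ht0, fun _ => rfl⟩
    have hc : ContinuousOn (fun a => dist x (γ a)) (Icc 0 1) := by fun_prop
    have := intermediate_value_Icc (zero_le_one (α := ℝ)) hc
    rw [h0, h1, dist_self] at this
    obtain ⟨a, ha, ha'⟩ := this (show (t : ℝ) * D ∈ Icc 0 D from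
      ⟨mul_nonneg t.2.1 hD0.le, mul_le_of_le_one_left hD0.le t.2.2⟩)
    exact ⟨a, ha, ha', fun h => absurd h ht0, fun h => absurd h ht1⟩
  choose σ hσ1 hσ2 hσ3 hσ4 using hσ
  refine ⟨fun t => γ (σ t), by simp [hσ3 0 rfl, h0], by simp [hσ4 1 rfl, h1], ?_⟩
  have key : ∀ s t : Icc (0 : ℝ) 1, σ s ≤ σ t →
      dist (γ (σ s)) (γ (σ t)) ≤ D * |(s : ℝ) - t| + ε := by
    intro s t hst
    have e1 := h _ _ (hσ1 s).1 hst (hσ1 t).2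
    have e2 := dist_triangle x (γ (σ t)) y
    rw [hσ2] at e1 e2
    have e3 : D * ((t : ℝ) - s) ≤ D * |(s : ℝ) - t| := by
      rw [abs_sub_comm]
      exact mul_le_mul_of_nonneg_left (le_abs_self _) hD0.le
    linarith
  intro s t
  rcases le_total (σ s) (σ t) with hst | hst
  · exact key s t hst
  · rw [dist_comm, abs_sub_comm]
    exact key t s hst

theorem HasApproxGeodesics.exists_dist_le (H : HasApproxGeodesics M) {x y : M} {r δ ε : ℝ}
    (hr : 0 ≤ r) (hδ : 0 ≤ δ) (hε : 0 < ε) (h : dist x y ≤ r + δ) :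
    ∃ z, dist x z ≤ r ∧ dist z y ≤ δ + ε := by
  set D := dist x y with hD
  by_cases h1 : D ≤ r
  · exact ⟨y, h1, by simp; linarith⟩
  by_cases h2 : r ≤ ε / 2
  · exact ⟨x, by simpa using hr, by linarith⟩
  push Not at h1 h2
  have hD0 : 0 < D := by linarith
  obtain ⟨f, f0, f1, hf⟩ := H x y (ε / 2) (by linarith)
  -- the time is reduced so that the error of the approximate geodesic does not lead out of the ball
  have ht : (r - ε / 2) / D ∈ Icc (0 : ℝ) 1 :=
    ⟨by apply div_nonneg <;> linarith, by rw [div_le_one hD0]; linarith⟩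
  set t : Icc (0 : ℝ) 1 := ⟨(r - ε / 2) / D, ht⟩ with htdef
  have htD : D * (t : ℝ) = r - ε / 2 := by simp only [htdef]; field_simp
  have e1 := hf 0 t
  have e2 := hf t 1
  rw [f0, Icc.coe_zero, zero_sub, abs_neg, abs_of_nonneg t.2.1, htD] at e1
  rw [f1, Icc.coe_one, abs_sub_comm, abs_of_nonneg (by linarith [t.2.2]), mul_sub, htD] at e2
  exact ⟨f t, by linarith, by linarith⟩

/-- The Hopf–Rinow theorem (in the version of Cohn-Vossen): the supremum of the radii of compact
balls around `x` cannot be finite, since the ball with that radius would be totally bounded, and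
compact sets have compact neighbourhoods. -/
theorem HasApproxGeodesics.properSpace [CompleteSpace M] [LocallyCompactSpace M]
    (H : HasApproxGeodesics M) : ProperSpace M := by
  refine ⟨fun x r₁ => ?_⟩
  by_contra hr₁
  set S := {r : ℝ | 0 ≤ r ∧ IsCompact (Metric.closedBall x r)} with hS
  have h0 : (0 : ℝ) ∈ S := ⟨le_rfl, by simp⟩
  have hbdd : ∀ r ∈ S, r ≤ r₁ := by
    intro r hr
    by_contra! hlt
    exact hr₁ (hr.2.of_isClosed_subset Metric.isClosed_closedBall
      (Metric.closedBall_subset_closedBall hlt.le))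
  have hB : BddAbove S := ⟨r₁, hbdd⟩
  set ρ := sSup S with hρ
  have hρ0 : 0 ≤ ρ := le_csSup hB h0
  have hcpt : IsCompact (Metric.closedBall x ρ) := by
    refine TotallyBounded.isCompact_of_isClosed ?_ Metric.isClosed_closedBall
    rw [Metric.totallyBounded_iff]
    intro ε hε
    obtain ⟨r, hr, hlt⟩ := exists_lt_of_lt_csSup ⟨0, h0⟩ (show ρ - ε / 3 < sSup S by linarith)
    obtain ⟨t, ht, hsub⟩ := Metric.totallyBounded_iff.1 hr.2.totallyBounded (ε / 3) (by linarith)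
    refine ⟨t, ht, fun y hy => ?_⟩
    obtain ⟨z, hz, hzy⟩ := H.exists_dist_le (x := x) (y := y) hr.1
      (show 0 ≤ ε / 3 by linarith) (show 0 < ε / 3 by linarith)
      (by rw [dist_comm]; linarith [Metric.mem_closedBall.1 hy])
    have hz' := hsub (show z ∈ Metric.closedBall x r by rwa [Metric.mem_closedBall, dist_comm])
    simp only [mem_iUnion, Metric.mem_ball, exists_prop] at hz' ⊢
    obtain ⟨w, hw, hzw⟩ := hz'
    refine ⟨w, hw, ?_⟩
    have := dist_triangle y z w
    rw [dist_comm y z] at this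
    linarith
  obtain ⟨δ, hδ, hδc⟩ := hcpt.exists_isCompact_cthickening
  have hmem : ρ + δ / 2 ∈ S := by
    refine ⟨by linarith, hδc.of_isClosed_subset Metric.isClosed_closedBall fun y hy => ?_⟩
    obtain ⟨z, hz, hzy⟩ := H.exists_dist_le (x := x) (y := y) hρ0
      (show 0 ≤ δ / 2 by linarith) (show 0 < δ / 2 by linarith)
      (by rw [dist_comm]; exact Metric.mem_closedBall.1 hy)
    exact Metric.mem_cthickening_of_dist_le y z δ _
      (by rwa [Metric.mem_closedBall, dist_comm]) (by rw [dist_comm]; linarith)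
  have := le_csSup hB hmem
  linarith

/-- Minimizing geodesics exist in proper spaces: they are limits of approximate ones in the
topology of pointwise convergence, in which the curves in a closed ball form a compact set. -/
theorem HasApproxGeodesics.exists_geodesic [ProperSpace M] (H : HasApproxGeodesics M) (x y : M) :
    ∃ γ : ℝ → M, γ 0 = x ∧ γ 1 = y ∧
      ∀ s ∈ Icc (0 : ℝ) 1, ∀ t ∈ Icc (0 : ℝ) 1, dist (γ s) (γ t) = dist x y * |s - t| := by
  set D := dist x y with hD
  set C : ℕ → Set (Icc (0 : ℝ) 1 → M) := fun n => {f | f 0 = x ∧ f 1 = y ∧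
    ∀ s t, dist (f s) (f t) ≤ D * |(s : ℝ) - t| + 1 / ((n : ℝ) + 1)} with hC
  have hcl : ∀ n, IsClosed (C n) := by
    intro n
    have : C n = {f | f 0 = x} ∩ ({f | f 1 = y} ∩
        ⋂ s : Icc (0 : ℝ) 1, ⋂ t : Icc (0 : ℝ) 1,
          {f | dist (f s) (f t) ≤ D * |(s : ℝ) - t| + 1 / ((n : ℝ) + 1)}) := by
      ext f
      simp only [hC, mem_ofPred_eq, mem_inter_iff, mem_iInter]
    rw [this]
    refine (isClosed_eq (continuous_apply _) continuous_const).inter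
      ((isClosed_eq (continuous_apply _) continuous_const).inter ?_)
    exact isClosed_iInter fun s => isClosed_iInter fun t =>
      isClosed_le ((continuous_apply _).dist (continuous_apply _)) continuous_const
  obtain ⟨f, hf⟩ := IsCompact.nonempty_iInter_of_sequence_nonempty_isCompact_isClosed C
    (fun n f hf => ⟨hf.1, hf.2.1, fun s t => (hf.2.2 s t).trans (by
      push_cast
      gcongr
      linarith)⟩)
    (fun n => H x y _ (by positivity))
    ((isCompact_univ_pi fun _ => isCompact_closedBall x (D + 1)).of_isClosed_subset (hcl 0)
      fun f hf s _ => by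
        have h1 := hf.2.2 s 0
        have h2 : D * |(s : ℝ) - (0 : Icc (0 : ℝ) 1)| ≤ D := by
          rw [Icc.coe_zero, sub_zero, abs_of_nonneg s.2.1]
          exact mul_le_of_le_one_right dist_nonneg s.2.2
        rw [hf.1] at h1
        simp only [Nat.cast_zero, zero_add, div_one] at h1
        exact Metric.mem_closedBall.2 (by linarith)) hcl
  rw [mem_iInter] at hf
  have hle : ∀ s t, dist (f s) (f t) ≤ D * |(s : ℝ) - t| := by
    intro s t
    refine le_of_forall_pos_le_add fun ε hε => ?_
    obtain ⟨n, hn⟩ := exists_nat_one_div_lt hε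
    linarith [(hf n).2.2 s t]
  have f0 := (hf 0).1
  have f1 := (hf 0).2.1
  have hge : ∀ s t : Icc (0 : ℝ) 1, (s : ℝ) ≤ t → D * (t - s) ≤ dist (f s) (f t) := by
    intro s t hst
    have e1 := hle 0 s
    have e2 := hle t 1
    have e3 := dist_triangle4 x (f s) (f t) y
    rw [f0, Icc.coe_zero, zero_sub, abs_neg, abs_of_nonneg s.2.1] at e1
    rw [f1, Icc.coe_one, abs_sub_comm, abs_of_nonneg (by linarith [t.2.2])] at e2
    linarith
  refine ⟨fun t => f (projIcc 0 1 zero_le_one t), ?_, ?_, fun s hs t ht => ?_⟩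
  · simpa using f0
  · simpa using f1
  · simp only [projIcc_of_mem zero_le_one hs, projIcc_of_mem zero_le_one ht]
    refine le_antisymm (hle _ _) ?_
    rcases le_total s t with h | h
    · rw [abs_sub_comm, abs_of_nonneg (sub_nonneg.2 h)]
      exact hge ⟨s, hs⟩ ⟨t, ht⟩ h
    · rw [abs_of_nonneg (sub_nonneg.2 h), dist_comm]
      exact hge ⟨t, ht⟩ ⟨s, hs⟩ h

/-- The endpoints of a geodesic segment of speed `c` have distance at most `c`. -/
theorem dist_zero_one_le {γ : ℝ → M} {c : ℝ}
    (h : ∀ t ∈ Icc (0 : ℝ) 1, ∃ ε > 0, ∀ t₁ ∈ Icc (0 : ℝ) 1, ∀ t₂ ∈ Icc (0 : ℝ) 1,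
      |t₁ - t| < ε → |t₂ - t| < ε → dist (γ t₁) (γ t₂) = c * |t₁ - t₂|) :
    dist (γ 0) (γ 1) ≤ c := by
  have hcont : ContinuousOn γ (Icc 0 1) := by
    intro t ht
    obtain ⟨ε, hε, h1⟩ := h t ht
    rw [ContinuousWithinAt, tendsto_iff_dist_tendsto_zero]
    have h2 : Tendsto (fun t₁ => c * |t₁ - t|) (𝓝[Icc 0 1] t) (𝓝 0) := by
      have : Continuous fun t₁ : ℝ => c * |t₁ - t| := by fun_prop
      have := (this.tendsto t).mono_left (nhdsWithin_le_nhds (s := Icc 0 1))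
      simpa using this
    refine h2.congr' ?_
    filter_upwards [self_mem_nhdsWithin, mem_nhdsWithin_of_mem_nhds (Metric.ball_mem_nhds t hε)]
      with t₁ ht₁ ht₁'
    exact (h1 t₁ ht₁ t ht ht₁' (by simpa using hε)).symm
  have hclosed : IsClosed ({t | dist (γ 0) (γ t) ≤ c * t} ∩ Icc 0 1) := by
    have : ContinuousOn (fun t => dist (γ 0) (γ t) - c * t) (Icc 0 1) := by fun_prop
    have := this.preimage_isClosed_of_isClosed isClosed_Icc (isClosed_Iic (a := (0 : ℝ)))
    rw [inter_comm]
    convert this using 2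
    ext t
    simp
  have hsub : Icc (0 : ℝ) 1 ⊆ {t | dist (γ 0) (γ t) ≤ c * t} := by
    refine hclosed.Icc_subset_of_forall_exists_gt (by simp) ?_
    rintro t ⟨ht, ht0, ht1⟩ y hy
    obtain ⟨ε, hε, h1⟩ := h t ⟨ht0, ht1.le⟩
    set t' := min (min y 1) (t + ε / 2)
    have htt' : t < t' := lt_min (lt_min hy ht1) (by linarith)
    have ht'1 : t' ≤ 1 := (min_le_left _ _).trans (min_le_right _ _)
    have ht'ε : t' ≤ t + ε / 2 := min_le_right _ _
    refine ⟨t', ?_, htt', (min_le_left _ _).trans (min_le_left _ _)⟩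
    have h2 := h1 t ⟨ht0, ht1.le⟩ t' ⟨by linarith, ht'1⟩ (by simpa using hε)
      (by rw [abs_of_pos (by linarith)]; linarith)
    rw [abs_sub_comm, abs_of_pos (by linarith)] at h2
    have h3 := dist_triangle (γ 0) (γ t) (γ t')
    have h4 : dist (γ 0) (γ t) ≤ c * t := ht
    show dist (γ 0) (γ t') ≤ c * t'
    linarith
  have : dist (γ 0) (γ 1) ≤ c * 1 := hsub (right_mem_Icc.2 zero_le_one)
  linarith

end LengthSpace

section Manifold

open Manifold MeasureTheory
open scoped ENNReal

/-! ### The chart at a point with values in the tangent space -/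

section Chart

variable {E : Type*} [NormedAddCommGroup E] [NormedSpace ℝ E]
  {M : Type*} [MetricSpace M] [ChartedSpace E M] [IsManifold 𝓘(ℝ, E) ∞ M]

/-- The derivative of the preferred chart at `x` in the point `y`, with values in the model space.
It is taken from the trivialization of the tangent bundle, and meaningful for `y` in the chart
domain only. -/
noncomputable def dchart (x y : M) : TangentSpace 𝓘(ℝ, E) y →L[ℝ] E :=
  (trivializationAt E (TangentSpace 𝓘(ℝ, E)) x).continuousLinearMapAt ℝ y

theorem dchart_eq_mfderiv {x y : M} (hy : y ∈ (chartAt E x).source) :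
    dchart x y = mfderiv 𝓘(ℝ, E) 𝓘(ℝ, E) (extChartAt 𝓘(ℝ, E) x) y :=
  TangentBundle.continuousLinearMapAt_trivializationAt hy

theorem dchart_self (x : M) (v : TangentSpace 𝓘(ℝ, E) x) : dchart x x v = (v : E) := by
  rw [dchart_eq_mfderiv (mem_chart_source E x), mfderiv_extChartAt_self]
  rfl

/-- The identification of the model space with the tangent space at `x` by the preferred chart. Its
values carry the Riemannian norm at `x`, which need not be the norm of the model space. -/
noncomputable def tangentEquiv (x : M) : E ≃L[ℝ] TangentSpace 𝓘(ℝ, E) x :=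
  ((trivializationAt E (TangentSpace 𝓘(ℝ, E)) x).continuousLinearEquivAt ℝ x
    (FiberBundle.mem_baseSet_trivializationAt' x)).symm

theorem tangentEquiv_dchart (x : M) (v : TangentSpace 𝓘(ℝ, E) x) :
    tangentEquiv x (dchart x x v) = v := by
  have h := (((trivializationAt E (TangentSpace 𝓘(ℝ, E)) x).continuousLinearEquivAt ℝ x
    (FiberBundle.mem_baseSet_trivializationAt' x))).symm_apply_apply v
  rw [tangentEquiv, dchart]
  convert! h
  simp [Bundle.Trivialization.coe_continuousLinearEquivAt_eq _
    (FiberBundle.mem_baseSet_trivializationAt' x)]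

theorem dchart_tangentEquiv (x : M) (w : E) : dchart x x (tangentEquiv x w) = w := by
  apply (tangentEquiv (E := E) x).injective
  exact tangentEquiv_dchart x _

variable [Bundle.RiemannianBundle (fun x : M => TangentSpace 𝓘(ℝ, E) x)]

/-- The squared Riemannian norm, read in the chart at `x`, is a quadratic form that depends
differentiably on the point. -/
theorem exists_metric
    [IsContMDiffRiemannianBundle 𝓘(ℝ, E) ∞ E (fun x : M => TangentSpace 𝓘(ℝ, E) x)] (x : M) :
    ∃ G : M → E →L[ℝ] E →L[ℝ] ℝ, MDifferentiableAt 𝓘(ℝ, E) 𝓘(ℝ, E →L[ℝ] E →L[ℝ] ℝ) G x ∧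
      ∀ y ∈ (chartAt E x).source, ∀ v : TangentSpace 𝓘(ℝ, E) y,
        ‖v‖ ^ 2 = G y (dchart x y v) (dchart x y v) := by
  obtain ⟨g, hg, hgi⟩ := IsContMDiffRiemannianBundle.exists_contMDiff (IB := 𝓘(ℝ, E)) (n := ∞)
    (F := E) (E := fun x : M => TangentSpace 𝓘(ℝ, E) x)
  refine ⟨fun y => ContinuousLinearMap.inCoordinates E (fun x : M => TangentSpace 𝓘(ℝ, E) x)
    (E →L[ℝ] ℝ)
    (fun x : M => TangentSpace 𝓘(ℝ, E) x →L[ℝ] ℝ) x y x y (g y), ?_, ?_⟩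
  · have W := hg.contMDiffAt (x := x)
    rw [contMDiffAt_hom_bundle] at W
    exact W.2.mdifferentiableAt (by simp)
  · intro y hy v
    have h'y : y ∈ (trivializationAt E (TangentSpace 𝓘(ℝ, E)) x).baseSet := hy
    rw [inCoordinates_apply_eq₂ h'y h'y (Set.mem_univ _)]
    have A : ((trivializationAt E (TangentSpace 𝓘(ℝ, E)) x).symm y) (dchart x y v) = v := by
      rw [dchart]
      convert! ((trivializationAt E (TangentSpace 𝓘(ℝ, E)) x).continuousLinearEquivAt ℝ _
        h'y).symm_apply_apply v
      simp [Bundle.Trivialization.coe_continuousLinearEquivAt_eq _ h'y]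
    rw [A, ← real_inner_self_eq_norm_sq, hgi]
    simp

end Chart

section NormComparison

variable {E : Type*} [NormedAddCommGroup E] [NormedSpace ℝ E]
  {M : Type*} [MetricSpace M] [ChartedSpace E M] [IsManifold 𝓘(ℝ, E) ∞ M]

/-- The chart at `x`, centred at `x` and with values in the tangent space at `x`. -/
noncomputable def tangentChart (x y : M) : TangentSpace 𝓘(ℝ, E) x :=
  tangentEquiv x (extChartAt 𝓘(ℝ, E) x y - extChartAt 𝓘(ℝ, E) x x)

omit [IsManifold 𝓘(ℝ, E) ∞ M] in
theorem exists_norm_sub_le_of_mdifferentiableAt {F : Type*} [NormedAddCommGroup F]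
    [NormedSpace ℝ F] {G : M → F} {x : M} (hG : MDifferentiableAt 𝓘(ℝ, E) 𝓘(ℝ, F) G x) :
    ∃ C : ℝ, 0 < C ∧ ∀ᶠ y in 𝓝 x,
      ‖G y - G x‖ ≤ C * ‖extChartAt 𝓘(ℝ, E) x y - extChartAt 𝓘(ℝ, E) x x‖ := by
  have h1 := ((mdifferentiableAt_iff _ _).1 hG).2
  simp only [modelWithCornersSelf_coe, range_id, differentiableWithinAt_univ] at h1
  obtain ⟨C, hC, hb⟩ := h1.isBigO_sub.exists_pos
  refine ⟨C, hC, ?_⟩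
  have h2 := (continuousAt_extChartAt (I := 𝓘(ℝ, E)) x).eventually hb.bound
  filter_upwards [h2, extChartAt_source_mem_nhds (I := 𝓘(ℝ, E)) x] with y hy hys
  have e : (extChartAt 𝓘(ℝ, E) x).symm (extChartAt 𝓘(ℝ, E) x y) = y :=
    (extChartAt 𝓘(ℝ, E) x).left_inv hys
  have e' : (extChartAt 𝓘(ℝ, E) x).symm (extChartAt 𝓘(ℝ, E) x x) = x :=
    (extChartAt 𝓘(ℝ, E) x).left_inv (mem_extChartAt_source x)
  simpa only [writtenInExtChartAt, Function.comp_apply, e, e', extChartAt_model_space_eq_id,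
    PartialEquiv.refl_coe, id_eq] using hy

variable [Bundle.RiemannianBundle (fun x : M => TangentSpace 𝓘(ℝ, E) x)]

theorem exists_norm_le_mul_norm_tangentEquiv (x : M) :
    ∃ k : ℝ, 0 < k ∧ ∀ w : E, ‖w‖ ≤ k * ‖tangentEquiv x w‖ := by
  obtain ⟨k, hk, h⟩ := ((tangentEquiv (E := E) x).symm : TangentSpace 𝓘(ℝ, E) x →L[ℝ] E).bound
  exact ⟨k, hk, fun w => by simpa using h (tangentEquiv x w)⟩

variable [IsContMDiffRiemannianBundle 𝓘(ℝ, E) ∞ E (fun x : M => TangentSpace 𝓘(ℝ, E) x)]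

set_option synthInstance.maxHeartbeats 200000 in
/-- The Riemannian norm at a point `y` near `x` differs from the one at `x` by a factor
`1 + O(|y - x|)`, since the metric is differentiable. -/
theorem exists_abs_norm_sub_le (x : M) : ∃ C : ℝ, 0 ≤ C ∧ ∀ᶠ y in 𝓝 x,
    ∀ v : TangentSpace 𝓘(ℝ, E) y, |‖v‖ - ‖tangentEquiv x (dchart x y v)‖| ≤
      C * ‖tangentChart (E := E) x y‖ * ‖tangentEquiv x (dchart x y v)‖ := by
  obtain ⟨G, hG, hGn⟩ := exists_metric (E := E) x
  obtain ⟨k, hk, hkw⟩ := exists_norm_le_mul_norm_tangentEquiv (E := E) x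
  obtain ⟨C, hC, hCw⟩ := exists_norm_sub_le_of_mdifferentiableAt hG
  refine ⟨C * k * k ^ 2, by positivity, ?_⟩
  filter_upwards [hCw, chart_source_mem_nhds E x] with y hy hys v
  set w := dchart x y v
  set n := ‖tangentEquiv x w‖
  have hn : n ^ 2 = G x w w := by
    have := hGn x (mem_chart_source E x) (tangentEquiv x w)
    rwa [dchart_tangentEquiv] at this
  have hv := hGn y hys v
  have h1 : |‖v‖ ^ 2 - n ^ 2| ≤ C * k * k ^ 2 * ‖tangentChart (E := E) x y‖ * n ^ 2 := by
    rw [hv, hn]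
    have : G y w w - G x w w = (G y - G x) w w := by simp
    rw [this, ← Real.norm_eq_abs]
    have h2 : ‖extChartAt 𝓘(ℝ, E) x y - extChartAt 𝓘(ℝ, E) x x‖ ≤
      k * ‖tangentChart (E := E) x y‖ := hkw _
    rw [← hn]
    calc ‖(G y - G x) w w‖ ≤ ‖G y - G x‖ * ‖w‖ * ‖w‖ := ContinuousLinearMap.le_opNorm₂ _ _ _
      _ ≤ (C * (k * ‖tangentChart (E := E) x y‖)) * (k * n) * (k * n) := by
          gcongr
          · exact hy.trans (by gcongr)
          · exact hkw w
          · exact hkw w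
      _ = _ := by ring
  have hv0 : 0 ≤ ‖v‖ := norm_nonneg v
  rcases (norm_nonneg (tangentEquiv x w)).eq_or_lt with h0 | h0
  · have hn0 : n = 0 := h0.symm
    rw [hn0] at h1 ⊢
    simp only [ne_eq, OfNat.ofNat_ne_zero, not_false_eq_true, zero_pow, sub_zero, mul_zero,
      abs_pow] at h1 ⊢
    nlinarith [abs_nonneg ‖v‖]
  · refine le_of_mul_le_mul_right ?_ h0
    calc |‖v‖ - n| * n ≤ |‖v‖ - n| * (‖v‖ + n) := by
          gcongr
          linarith
      _ = |‖v‖ ^ 2 - n ^ 2| := by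
          rw [← abs_of_nonneg (add_nonneg hv0 h0.le), ← abs_mul]
          congr 1
          ring
      _ ≤ _ := h1.trans (le_of_eq (by ring))

end NormComparison

/-! ### Lengths of curves and distances in the chart -/

section Length

variable {E : Type*} [NormedAddCommGroup E] [NormedSpace ℝ E]
  {M : Type*} [MetricSpace M] [ChartedSpace E M] [IsManifold 𝓘(ℝ, E) ∞ M]

theorem tangentChart_self (x : M) : tangentChart (E := E) x x = 0 := by
  simp [tangentChart]

variable [Bundle.RiemannianBundle (fun x : M => TangentSpace 𝓘(ℝ, E) x)]

theorem hasDerivWithinAt_tangentChart_comp (x : M) {γ : ℝ → M} {s : Set ℝ} {t : ℝ}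
    (hγ : MDifferentiableWithinAt 𝓘(ℝ, ℝ) 𝓘(ℝ, E) γ s t) (ht : γ t ∈ (chartAt E x).source) :
    HasDerivWithinAt (fun t => tangentChart (E := E) x (γ t))
      (tangentEquiv x (dchart x (γ t) (mfderivWithin 𝓘(ℝ, ℝ) 𝓘(ℝ, E) γ s t 1))) s t := by
  have h1 : HasMFDerivWithinAt 𝓘(ℝ, ℝ) 𝓘(ℝ, E) (extChartAt 𝓘(ℝ, E) x ∘ γ) s t
      ((mfderiv 𝓘(ℝ, E) 𝓘(ℝ, E) (extChartAt 𝓘(ℝ, E) x) (γ t)).comp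
        (mfderivWithin 𝓘(ℝ, ℝ) 𝓘(ℝ, E) γ s t)) :=
    (mdifferentiableAt_extChartAt ht).hasMFDerivAt.comp_hasMFDerivWithinAt t
      hγ.hasMFDerivWithinAt
  have h2 : HasDerivWithinAt (extChartAt 𝓘(ℝ, E) x ∘ γ)
      (dchart x (γ t) (mfderivWithin 𝓘(ℝ, ℝ) 𝓘(ℝ, E) γ s t 1)) s t := by
    have h1' : HasFDerivWithinAt (extChartAt 𝓘(ℝ, E) x ∘ γ)
        ((dchart x (γ t)).comp (mfderivWithin 𝓘(ℝ, ℝ) 𝓘(ℝ, E) γ s t) : ℝ →L[ℝ] E) s t := by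
      rw [dchart_eq_mfderiv ht]
      exact h1.hasFDerivWithinAt
    exact h1'.hasDerivWithinAt
  have h3 := (tangentEquiv (E := E) x : E →L[ℝ] TangentSpace 𝓘(ℝ, E) x).hasFDerivAt
    (x := extChartAt 𝓘(ℝ, E) x (γ t) - extChartAt 𝓘(ℝ, E) x x)
  exact h3.comp_hasDerivWithinAt t (h2.sub_const _)

/-- If the Riemannian norm is bounded below along a curve by `c` times the norm at `x`, then the
length of the curve is bounded below by `c` times the length of its chord in the chart at `x`. -/
theorem ofReal_mul_norm_sub_le_pathELength (x : M) {γ : ℝ → M}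
    (hγ : ContMDiffOn 𝓘(ℝ, ℝ) 𝓘(ℝ, E) 1 γ (Icc 0 1)) {c : ℝ}
    (h : ∀ t ∈ Icc (0 : ℝ) 1, γ t ∈ (chartAt E x).source ∧ ∀ v : TangentSpace 𝓘(ℝ, E) (γ t),
      c * ‖tangentEquiv x (dchart x (γ t) v)‖ ≤ ‖v‖) :
    ENNReal.ofReal (c * ‖tangentChart (E := E) x (γ 1) - tangentChart (E := E) x (γ 0)‖) ≤
      pathELength 𝓘(ℝ, E) γ 0 1 := by
  rcases le_total c 0 with hc | hc
  · rw [ENNReal.ofReal_of_nonpos (mul_nonpos_of_nonpos_of_nonneg hc (norm_nonneg _))]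
    exact zero_le
  have hd : ∀ t ∈ Icc (0 : ℝ) 1, HasDerivWithinAt (fun t => tangentChart (E := E) x (γ t))
      (tangentEquiv x (dchart x (γ t) (mfderivWithin 𝓘(ℝ, ℝ) 𝓘(ℝ, E) γ (Icc 0 1) t 1)))
      (Icc 0 1) t := fun t ht =>
    hasDerivWithinAt_tangentChart_comp x (hγ.mdifferentiableOn one_ne_zero t ht) (h t ht).1
  have hC : ContDiffOn ℝ 1 (fun t => tangentChart (E := E) x (γ t)) (Icc 0 1) := by
    have h1 : ContMDiffOn 𝓘(ℝ, ℝ) 𝓘(ℝ, E) 1 (extChartAt 𝓘(ℝ, E) x ∘ γ) (Icc 0 1) :=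
      contMDiffOn_extChartAt.comp (t := (chartAt E x).source) hγ fun t ht => (h t ht).1
    have h2 := contMDiffOn_iff_contDiffOn.1 h1
    exact (tangentEquiv (E := E) x : E →L[ℝ] TangentSpace 𝓘(ℝ, E) x).contDiff.comp_contDiffOn
      (h2.sub contDiffOn_const)
  rw [pathELength_eq_lintegral_mfderivWithin_Icc, ENNReal.ofReal_mul hc, ofReal_norm]
  refine (mul_le_mul_right (enorm_sub_le_lintegral_derivWithin_Icc_of_contDiffOn_Icc hC
    zero_le_one) _).trans ?_
  rw [← lintegral_const_mul' _ _ ENNReal.ofReal_ne_top]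
  refine setLIntegral_mono' measurableSet_Icc fun t ht => ?_
  rw [(hd t ht).derivWithin (uniqueDiffOn_Icc zero_lt_one t ht), ← ofReal_norm, ← ofReal_norm,
    ← ENNReal.ofReal_mul hc]
  exact ENNReal.ofReal_le_ofReal ((h t ht).2 _)

end Length

section LengthDistance

variable {E : Type*} [NormedAddCommGroup E] [NormedSpace ℝ E]
  {M : Type*} [MetricSpace M] [ChartedSpace E M] [IsManifold 𝓘(ℝ, E) ∞ M]

variable [Bundle.RiemannianBundle (fun x : M => TangentSpace 𝓘(ℝ, E) x)]

/-- A curve that is straight in the chart at `x` has a length of at most `c` times the length of its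
chord if the Riemannian norm along the curve is at most `c` times the norm at `x`. -/
theorem pathELength_le_of_tangentChart_eq (x : M) {γ : ℝ → M} {w₀ w : TangentSpace 𝓘(ℝ, E) x}
    (hγ : ContMDiffOn 𝓘(ℝ, ℝ) 𝓘(ℝ, E) 1 γ (Icc 0 1)) {c : ℝ}
    (hw : ∀ t ∈ Icc (0 : ℝ) 1, tangentChart x (γ t) = w₀ + t • w)
    (h : ∀ t ∈ Icc (0 : ℝ) 1, γ t ∈ (chartAt E x).source ∧ ∀ v : TangentSpace 𝓘(ℝ, E) (γ t),
      ‖v‖ ≤ c * ‖tangentEquiv x (dchart x (γ t) v)‖) :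
    pathELength 𝓘(ℝ, E) γ 0 1 ≤ ENNReal.ofReal (c * ‖w‖) := by
  have hd : ∀ t ∈ Icc (0 : ℝ) 1,
      tangentEquiv x (dchart x (γ t) (mfderivWithin 𝓘(ℝ, ℝ) 𝓘(ℝ, E) γ (Icc 0 1) t 1)) = w := by
    intro t ht
    have h1 := hasDerivWithinAt_tangentChart_comp x (hγ.mdifferentiableOn one_ne_zero t ht)
      (h t ht).1
    have h2 : HasDerivWithinAt (fun t => tangentChart x (γ t)) w (Icc 0 1) t := by
      have : HasDerivWithinAt (fun t : ℝ => w₀ + t • w) ((1 : ℝ) • w) (Icc 0 1) t :=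
        ((hasDerivWithinAt_id t _).smul_const w).const_add w₀
      rw [one_smul] at this
      exact this.congr hw (hw t ht)
    exact (uniqueDiffOn_Icc zero_lt_one t ht).eq_deriv _ h1 h2
  rw [pathELength_eq_lintegral_mfderivWithin_Icc]
  calc ∫⁻ t in Icc (0 : ℝ) 1, ‖mfderivWithin 𝓘(ℝ, ℝ) 𝓘(ℝ, E) γ (Icc 0 1) t 1‖ₑ
      ≤ ∫⁻ t in Icc (0 : ℝ) 1, ENNReal.ofReal (c * ‖w‖) := by
        refine setLIntegral_mono' measurableSet_Icc fun t ht => ?_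
        rw [← ofReal_norm]
        have := (h t ht).2 (mfderivWithin 𝓘(ℝ, ℝ) 𝓘(ℝ, E) γ (Icc 0 1) t 1)
        rw [hd t ht] at this
        exact ENNReal.ofReal_le_ofReal this
    _ = ENNReal.ofReal (c * ‖w‖) := by simp

variable [IsRiemannianManifold 𝓘(ℝ, E) M]

omit [IsManifold 𝓘(ℝ, E) ∞ M] in
theorem edist_le_pathELength {γ : ℝ → M} {a b : ℝ} (hab : a ≤ b)
    (hγ : ContMDiffOn 𝓘(ℝ, ℝ) 𝓘(ℝ, E) 1 γ (Icc a b)) :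
    edist (γ a) (γ b) ≤ pathELength 𝓘(ℝ, E) γ a b := by
  rw [IsRiemannianManifold.out (I := 𝓘(ℝ, E)) (γ a) (γ b)]
  exact riemannianEDist_le_pathELength hγ rfl rfl hab

omit [IsManifold 𝓘(ℝ, E) ∞ M] in
theorem exists_pathELength_lt (y z : M) {r : ℝ} (h : dist y z < r) :
    ∃ γ : ℝ → M, γ 0 = y ∧ γ 1 = z ∧ ContMDiffOn 𝓘(ℝ, ℝ) 𝓘(ℝ, E) 1 γ (Icc 0 1) ∧
      pathELength 𝓘(ℝ, E) γ 0 1 < ENNReal.ofReal r := by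
  refine exists_lt_of_riemannianEDist_lt ?_
  rw [← IsRiemannianManifold.out (I := 𝓘(ℝ, E)) y z, edist_dist]
  exact (ENNReal.ofReal_lt_ofReal_iff (dist_nonneg.trans_lt h)).2 h

/-- A short curve between points near `x` stays near `x`, so that the length of its chord in the
chart at `x` is controlled by a bound of the Riemannian norm near `x`. -/
theorem mul_norm_tangentChart_sub_le_dist (x : M) {r c : ℝ}
    (h : ∀ y ∈ Metric.ball x (3 * r), y ∈ (chartAt E x).source ∧
      ∀ v : TangentSpace 𝓘(ℝ, E) y, c * ‖tangentEquiv x (dchart x y v)‖ ≤ ‖v‖)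
    {y z : M} (hy : y ∈ Metric.ball x r) (hz : z ∈ Metric.ball x r) :
    c * ‖tangentChart (E := E) x y - tangentChart (E := E) x z‖ ≤ dist y z := by
  have hyz : dist z y < 2 * r := by
    have := dist_triangle_right z y x
    rw [Metric.mem_ball] at hy hz
    linarith
  rw [dist_comm y z]
  refine le_of_forall_gt_imp_ge_of_dense fun b hb => ?_
  have hb' : dist z y < min b (2 * r) := lt_min hb hyz
  obtain ⟨γ, h0, h1, hγ, hl⟩ := exists_pathELength_lt (E := E) z y hb'
  have hmem : ∀ t ∈ Icc (0 : ℝ) 1, γ t ∈ Metric.ball x (3 * r) := by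
    intro t ht
    have e1 : edist (γ 0) (γ t) < ENNReal.ofReal (min b (2 * r)) :=
      ((edist_le_pathELength ht.1 (hγ.mono (Icc_subset_Icc_right ht.2))).trans
        (pathELength_mono le_rfl ht.2)).trans_lt hl
    rw [edist_dist, ENNReal.ofReal_lt_ofReal_iff (dist_nonneg.trans_lt hb'), h0] at e1
    have e2 := dist_triangle_left (γ t) x z
    rw [Metric.mem_ball] at hz ⊢
    linarith [min_le_right b (2 * r)]
  have key := (ofReal_mul_norm_sub_le_pathELength x hγ fun t ht => h _ (hmem t ht)).trans hl.le
  rw [h0, h1, ENNReal.ofReal_le_ofReal_iff (dist_nonneg.trans hb'.le)] at key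
  exact key.trans (min_le_left _ _)

/-- The inverse of the chart at `x` with values in the tangent space at `x`. -/
noncomputable def tangentChartSymm (x : M) (p : TangentSpace 𝓘(ℝ, E) x) : M :=
  (extChartAt 𝓘(ℝ, E) x).symm (extChartAt 𝓘(ℝ, E) x x + (tangentEquiv x).symm p)

/-- The curve that is a segment in the chart at `x` bounds the distance of its endpoints. -/
theorem dist_le_mul_norm_tangentChart_sub (x : M) {c η : ℝ}
    (h : ∀ p : TangentSpace 𝓘(ℝ, E) x, ‖p‖ < η →
      extChartAt 𝓘(ℝ, E) x x + (tangentEquiv x).symm p ∈ (extChartAt 𝓘(ℝ, E) x).target ∧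
      ∀ v : TangentSpace 𝓘(ℝ, E) (tangentChartSymm x p),
        ‖v‖ ≤ c * ‖tangentEquiv x (dchart x (tangentChartSymm x p) v)‖)
    (hc : 0 ≤ c) {y z : M} (hys : y ∈ (chartAt E x).source) (hzs : z ∈ (chartAt E x).source)
    (hy : ‖tangentChart (E := E) x y‖ < η) (hz : ‖tangentChart (E := E) x z‖ < η) :
    dist y z ≤ c * ‖tangentChart (E := E) x y - tangentChart (E := E) x z‖ := by
  set w₀ := tangentChart (E := E) x z with hw₀
  set w := tangentChart (E := E) x y - w₀ with hw
  have hη : ∀ t ∈ Icc (0 : ℝ) 1, ‖w₀ + t • w‖ < η := by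
    intro t ht
    have h1 : w₀ + t • w = (1 - t) • w₀ + t • tangentChart (E := E) x y := by
      rw [hw]; module
    have h2 := (convex_ball (0 : TangentSpace 𝓘(ℝ, E) x) η)
      (show w₀ ∈ Metric.ball (0 : TangentSpace 𝓘(ℝ, E) x) η by simpa using hz)
      (show tangentChart (E := E) x y ∈ Metric.ball (0 : TangentSpace 𝓘(ℝ, E) x) η by
        simpa using hy) (sub_nonneg.2 ht.2) ht.1 (by ring)
    rw [← h1] at h2
    simpa using h2
  have hinv : ∀ p : TangentSpace 𝓘(ℝ, E) x, ‖p‖ < η →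
      tangentChartSymm x p ∈ (chartAt E x).source ∧ tangentChart x (tangentChartSymm x p) = p := by
    intro p hp
    refine ⟨?_, ?_⟩
    · have := (extChartAt 𝓘(ℝ, E) x).map_target (h p hp).1
      rwa [extChartAt_source] at this
    · rw [tangentChart, tangentChartSymm, (extChartAt 𝓘(ℝ, E) x).right_inv (h p hp).1,
        add_sub_cancel_left]
      simp
  have hsymm : ∀ a ∈ (chartAt E x).source, tangentChartSymm x (tangentChart (E := E) x a) = a := by
    intro a ha
    rw [tangentChart, tangentChartSymm]
    simp only [ContinuousLinearEquiv.symm_apply_apply, add_sub_cancel]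
    exact (extChartAt 𝓘(ℝ, E) x).left_inv (by rwa [extChartAt_source])
  set γ : ℝ → M := fun t => tangentChartSymm x (w₀ + t • w) with hγdef
  have h0 : γ 0 = z := by simp [hγdef, hw₀, hsymm z hzs]
  have h1 : γ 1 = y := by simp [hγdef, hw, hsymm y hys]
  have hγ : ContMDiffOn 𝓘(ℝ, ℝ) 𝓘(ℝ, E) 1 γ (Icc 0 1) := by
    have e1 : ContDiff ℝ 1 fun t : ℝ => extChartAt 𝓘(ℝ, E) x x +
        (tangentEquiv (E := E) x).symm (w₀ + t • w) := by
      refine contDiff_const.add (((tangentEquiv (E := E) x).symm :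
        TangentSpace 𝓘(ℝ, E) x →L[ℝ] E).contDiff.comp ?_)
      exact contDiff_const.add (contDiff_id.smul contDiff_const)
    exact (contMDiffOn_extChartAt_symm x).comp e1.contMDiff.contMDiffOn
      fun t ht => (h _ (hη t ht)).1
  have key := pathELength_le_of_tangentChart_eq x hγ (c := c) (w₀ := w₀) (w := w)
    (fun t ht => (hinv _ (hη t ht)).2)
    fun t ht => ⟨(hinv _ (hη t ht)).1, (h _ (hη t ht)).2⟩
  have key2 := (edist_le_pathELength zero_le_one hγ).trans key
  rw [h0, h1, edist_dist, ENNReal.ofReal_le_ofReal_iff (mul_nonneg hc (norm_nonneg _)),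
    dist_comm] at key2
  exact key2

end LengthDistance

section DistanceComparison

variable {E : Type*} [NormedAddCommGroup E] [NormedSpace ℝ E]
  {M : Type*} [MetricSpace M] [ChartedSpace E M] [IsManifold 𝓘(ℝ, E) ∞ M]

variable [Bundle.RiemannianBundle (fun x : M => TangentSpace 𝓘(ℝ, E) x)]

theorem tendsto_tangentChart (x : M) :
    Tendsto (fun y => ‖tangentChart (E := E) x y‖) (𝓝 x) (𝓝 0) := by
  have h1 : ContinuousAt (fun y => ‖tangentChart (E := E) x y‖) x := by
    have h2 : ContinuousAt (fun y => tangentChart (E := E) x y) x :=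
      (tangentEquiv (E := E) x).continuous.continuousAt.comp
        ((continuousAt_extChartAt x).sub continuousAt_const)
    exact h2.norm
  have := h1.tendsto
  rwa [tangentChart_self, norm_zero] at this

section Comparison

variable [IsContMDiffRiemannianBundle 𝓘(ℝ, E) ∞ E (fun x : M => TangentSpace 𝓘(ℝ, E) x)]
  [IsRiemannianManifold 𝓘(ℝ, E) M]

/-- In a ball of radius `r` around `x`, the Riemannian distance differs by `O(r ^ 2)` from the
distance in the chart at `x` with respect to the inner product at `x`. -/
theorem exists_abs_dist_sub_norm_le (x : M) : ∃ K ρ : ℝ, 0 ≤ K ∧ 0 < ρ ∧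
    ∀ r, 0 < r → r < ρ → ∀ y ∈ Metric.ball x r, ∀ z ∈ Metric.ball x r,
      y ∈ (chartAt E x).source ∧
      |dist y z - ‖tangentChart (E := E) x y - tangentChart (E := E) x z‖| ≤ K * r ^ 2 := by
  obtain ⟨C, hC, hev⟩ := exists_abs_norm_sub_le (E := E) x
  set Q : M → Prop := fun y => ∀ v : TangentSpace 𝓘(ℝ, E) y,
    |‖v‖ - ‖tangentEquiv x (dchart x y v)‖| ≤
      C * ‖tangentChart (E := E) x y‖ * ‖tangentEquiv x (dchart x y v)‖ with hQ
  have hev2 : ∀ᶠ y in 𝓝 x,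
      (y ∈ (chartAt E x).source ∧ C * ‖tangentChart (E := E) x y‖ ≤ 1 / 2) ∧ Q y := by
    refine Eventually.and (Eventually.and (chart_source_mem_nhds E x) ?_) hev
    have h1 := (tendsto_tangentChart (E := E) x).const_mul C
    rw [mul_zero] at h1
    exact (h1.eventually (gt_mem_nhds (show (0 : ℝ) < 1 / 2 by norm_num))).mono fun y hy => hy.le
  obtain ⟨ρ, hρ, hball⟩ := Metric.eventually_nhds_iff_ball.1 hev2
  obtain ⟨η, hη, hηp⟩ : ∃ η > 0, ∀ p : TangentSpace 𝓘(ℝ, E) x, ‖p‖ < η →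
      extChartAt 𝓘(ℝ, E) x x + (tangentEquiv x).symm p ∈ (extChartAt 𝓘(ℝ, E) x).target ∧
      Q (tangentChartSymm x p) := by
    have hcont : ContinuousAt (fun p : TangentSpace 𝓘(ℝ, E) x =>
        extChartAt 𝓘(ℝ, E) x x + (tangentEquiv (E := E) x).symm p) 0 :=
      (continuous_const.add (tangentEquiv (E := E) x).symm.continuous).continuousAt
    have hev3 : ∀ᶠ e in 𝓝 (extChartAt 𝓘(ℝ, E) x x), e ∈ (extChartAt 𝓘(ℝ, E) x).target ∧
        Q ((extChartAt 𝓘(ℝ, E) x).symm e) := by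
      refine Eventually.and (extChartAt_target_mem_nhds x) ?_
      have h1 := continuousAt_extChartAt_symm (I := 𝓘(ℝ, E)) x
      exact h1.eventually (by rwa [extChartAt_to_inv])
    have h2 := hcont.eventually (p := fun e => e ∈ (extChartAt 𝓘(ℝ, E) x).target ∧
        Q ((extChartAt 𝓘(ℝ, E) x).symm e)) (by simpa using hev3)
    obtain ⟨η, hη, h3⟩ := Metric.eventually_nhds_iff_ball.1 h2
    exact ⟨η, hη, fun p hp => h3 p (by simpa using hp)⟩
  -- A crude comparison, with a factor `2`, turns the distortion of the norms into `O(dist x y)`.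
  have hcrude : ∀ y ∈ Metric.ball x (ρ / 3), ∀ z ∈ Metric.ball x (ρ / 3),
      ‖tangentChart (E := E) x y - tangentChart (E := E) x z‖ ≤ 2 * dist y z := by
    intro y hy z hz
    have := mul_norm_tangentChart_sub_le_dist (E := E) x (r := ρ / 3) (c := 1 / 2)
      (fun a ha => by
        have ha' := hball a (by rwa [mul_div_cancel₀ ρ (three_ne_zero)] at ha)
        refine ⟨ha'.1.1, fun v => ?_⟩
        have h1 := (abs_le.1 (ha'.2 v)).1
        have h2 := mul_le_mul_of_nonneg_right ha'.1.2
          (norm_nonneg (tangentEquiv x (dchart x a v)))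
        linarith) hy hz
    linarith
  have hcrude0 : ∀ y ∈ Metric.ball x (ρ / 3), ‖tangentChart (E := E) x y‖ ≤ 2 * dist y x := by
    intro y hy
    have := hcrude y hy x (Metric.mem_ball_self (by positivity))
    rwa [tangentChart_self, sub_zero] at this
  refine ⟨24 * C, min (ρ / 9) (η / 2), by positivity, by positivity, fun r hr hrρ y hy z hz => ?_⟩
  have hr9 : r < ρ / 9 := hrρ.trans_le (min_le_left _ _)
  have hrη : r < η / 2 := hrρ.trans_le (min_le_right _ _)
  have hsub : ∀ a ∈ Metric.ball x r, a ∈ Metric.ball x (ρ / 3) := fun a ha =>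
    Metric.ball_subset_ball (by linarith) ha
  have hs : ∀ a ∈ Metric.ball x r, a ∈ (chartAt E x).source := fun a ha =>
    (hball a (Metric.ball_subset_ball (by linarith) ha)).1.1
  have hlt : ∀ a ∈ Metric.ball x r, ‖tangentChart (E := E) x a‖ < 2 * r := fun a ha => by
    have := hcrude0 a (hsub a ha)
    linarith [Metric.mem_ball.1 ha]
  refine ⟨hs y hy, ?_⟩
  set Δ := ‖tangentChart (E := E) x y - tangentChart (E := E) x z‖ with hΔ
  have hΔr : Δ ≤ 4 * r := by
    have := norm_sub_le (tangentChart (E := E) x y) (tangentChart (E := E) x z)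
    linarith [hlt y hy, hlt z hz]
  -- short curves between such points stay in the ball of radius `3 * r` around `x`, where
  -- the chart takes values of norm at most `6 * r`
  have lower : (1 - 6 * C * r) * Δ ≤ dist y z := by
    refine mul_norm_tangentChart_sub_le_dist (E := E) x (r := r) (fun a ha => ?_) hy hz
    have ha3 : a ∈ Metric.ball x (ρ / 3) := Metric.ball_subset_ball (by linarith) ha
    have ha' := hball a (Metric.ball_subset_ball (by linarith) ha)
    refine ⟨ha'.1.1, fun v => ?_⟩
    have h1 := (abs_le.1 (ha'.2 v)).1
    have h2 : C * ‖tangentChart (E := E) x a‖ * ‖tangentEquiv x (dchart x a v)‖ ≤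
        C * (6 * r) * ‖tangentEquiv x (dchart x a v)‖ := by
      gcongr
      linarith [hcrude0 a ha3, Metric.mem_ball.1 ha]
    linarith
  -- segments between such points stay in the ball of radius `2 * r` of the tangent space
  have upper : dist y z ≤ (1 + 2 * C * r) * Δ := by
    refine dist_le_mul_norm_tangentChart_sub x (η := 2 * r) (fun p hp => ?_) (by positivity)
      (hs y hy) (hs z hz) (hlt y hy) (hlt z hz)
    obtain ⟨h1, h2⟩ := hηp p (by linarith)
    refine ⟨h1, fun v => ?_⟩
    have h3 := (abs_le.1 (h2 v)).2
    have h4 : tangentChart x (tangentChartSymm x p) = p := by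
      rw [tangentChart, tangentChartSymm, (extChartAt 𝓘(ℝ, E) x).right_inv h1,
        add_sub_cancel_left]
      simp
    rw [h4] at h3
    have h5 : C * ‖p‖ * ‖tangentEquiv x (dchart x (tangentChartSymm x p) v)‖ ≤
        C * (2 * r) * ‖tangentEquiv x (dchart x (tangentChartSymm x p) v)‖ := by
      gcongr
    linarith
  have hCr : C * r * Δ ≤ C * r * (4 * r) := by gcongr
  rw [abs_le]
  constructor <;> nlinarith

end Comparison

end DistanceComparison

/-! ### Initial velocities of geodesics and details -/

section Velocities

variable {E : Type*} [NormedAddCommGroup E] [NormedSpace ℝ E]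
  {M : Type*} [MetricSpace M] [ChartedSpace E M] [IsManifold 𝓘(ℝ, E) ∞ M]

variable [Bundle.RiemannianBundle (fun x : M => TangentSpace 𝓘(ℝ, E) x)]

omit [IsManifold 𝓘(ℝ, E) ∞ M] in
theorem hasApproxGeodesics_of_isRiemannianManifold [IsRiemannianManifold 𝓘(ℝ, E) M] :
    HasApproxGeodesics M := by
  refine hasApproxGeodesics_of_exists_continuousOn fun x y ε hε => ?_
  obtain ⟨γ, h0, h1, hγ, hl⟩ := exists_pathELength_lt (E := E) x y
    (show dist x y < dist x y + ε by linarith)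
  refine ⟨γ, hγ.continuousOn, h0, h1, fun a b ha hab hb => ?_⟩
  have e1 := edist_le_pathELength ha (hγ.mono (Icc_subset_Icc_right (hab.trans hb)))
  have e2 := edist_le_pathELength hab (hγ.mono (Icc_subset_Icc ha hb))
  have e3 := edist_le_pathELength hb (hγ.mono (Icc_subset_Icc_left (ha.trans hab)))
  have e4 : edist (γ 0) (γ a) + edist (γ a) (γ b) + edist (γ b) (γ 1) ≤
      ENNReal.ofReal (dist x y + ε) := by
    refine le_trans ?_ hl.le
    rw [← pathELength_add ha (hab.trans hb), ← pathELength_add hab hb, ← add_assoc]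
    gcongr
  rw [edist_dist, edist_dist, edist_dist, ← ENNReal.ofReal_add dist_nonneg dist_nonneg,
    ← ENNReal.ofReal_add (by positivity) dist_nonneg,
    ENNReal.ofReal_le_ofReal_iff (by positivity), h0, h1] at e4
  exact e4

/-- The derivative of a curve in its starting point, in terms of the chart there. -/
theorem hasMFDerivWithinAt_zero_iff {γ : ℝ → M} (hcont : ContinuousWithinAt γ (Icc 0 1) 0)
    (v : TangentSpace 𝓘(ℝ, E) (γ 0)) :
    HasMFDerivWithinAt 𝓘(ℝ, ℝ) 𝓘(ℝ, E) γ (Icc 0 1) 0 (ContinuousLinearMap.toSpanSingleton ℝ v) ↔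
      Tendsto (fun t => t⁻¹ • tangentChart (γ 0) (γ t)) (𝓝[>] 0) (𝓝 v) := by
  have hslope : Tendsto (fun t => t⁻¹ • tangentChart (E := E) (γ 0) (γ t)) (𝓝[>] 0) (𝓝 v) ↔
      HasDerivWithinAt (fun t => tangentChart (E := E) (γ 0) (γ t)) v (Icc 0 1) 0 := by
    have h1 : HasDerivWithinAt (fun t => tangentChart (E := E) (γ 0) (γ t)) v (Icc 0 1) 0 ↔
        HasDerivWithinAt (fun t => tangentChart (E := E) (γ 0) (γ t)) v (Ioi 0) 0 := by
      rw [hasDerivWithinAt_Ioi_iff_Ici]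
      exact ⟨fun h => h.mono_of_mem_nhdsWithin (Icc_mem_nhdsGE zero_lt_one),
        fun h => h.mono Icc_subset_Ici_self⟩
    rw [h1, hasDerivWithinAt_iff_tendsto_slope' self_notMem_Ioi]
    refine tendsto_congr fun t => ?_
    simp [slope, tangentChart_self]
  rw [hslope]
  constructor
  · intro h
    have h1 := hasDerivWithinAt_tangentChart_comp (γ 0) h.mdifferentiableWithinAt
      (mem_chart_source E (γ 0))
    rw [tangentEquiv_dchart, h.mfderivWithin (uniqueMDiffWithinAt_iff_uniqueDiffWithinAt.2
      (uniqueDiffOn_Icc zero_lt_one _ (left_mem_Icc.2 zero_le_one)))] at h1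
    exact h1.congr_deriv (one_smul ℝ v)
  · intro h
    refine ⟨hcont, ?_⟩
    have h1 := ((tangentEquiv (E := E) (γ 0)).symm :
      TangentSpace 𝓘(ℝ, E) (γ 0) →L[ℝ] E).hasFDerivAt
        (x := tangentChart (E := E) (γ 0) (γ 0)) |>.comp_hasDerivWithinAt (0 : ℝ) h
    have h2 : (tangentEquiv (E := E) (γ 0)).symm v = (v : E) :=
      ((tangentEquiv (E := E) (γ 0)).symm_apply_eq.2 (tangentEquiv_dchart (γ 0) v).symm).trans
        (dchart_self (γ 0) v)
    have h3 : HasDerivWithinAt (fun t => extChartAt 𝓘(ℝ, E) (γ 0) (γ t)) (v : E) (Icc 0 1) 0 := by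
      have := h1.add_const (extChartAt 𝓘(ℝ, E) (γ 0) (γ 0))
      refine (this.congr_deriv h2).congr_of_eventuallyEq ?_ ?_ <;>
      simp [tangentChart]
    have h4 : HasFDerivWithinAt (writtenInExtChartAt 𝓘(ℝ, ℝ) 𝓘(ℝ, E) 0 γ)
        (ContinuousLinearMap.toSpanSingleton ℝ (v : E)) (Icc 0 1) 0 := h3.hasFDerivWithinAt
    exact h4.mono inter_subset_left

section Geodesics

variable [IsContMDiffRiemannianBundle 𝓘(ℝ, E) ∞ E (fun x : M => TangentSpace 𝓘(ℝ, E) x)]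
  [IsRiemannianManifold 𝓘(ℝ, E) M]

/-- Up to a quadratic error, a geodesic looks like a straight line of the same speed in the chart at
its starting point. -/
theorem exists_abs_norm_tangentChart_sub_le {γ : ℝ → M} {c ε : ℝ} (hc : 0 ≤ c) (hε : 0 < ε)
    (hγ : ∀ s ∈ Ico 0 ε, ∀ t ∈ Ico 0 ε, dist (γ s) (γ t) = c * |s - t|) :
    ∃ K δ : ℝ, 0 ≤ K ∧ 0 < δ ∧ ∀ t, 0 < t → t < δ → ∀ s ∈ Icc 0 t, ∀ s' ∈ Icc 0 t,
      |(‖tangentChart (E := E) (γ 0) (γ s) - tangentChart (E := E) (γ 0) (γ s')‖ -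
        c * |s - s'|)| ≤ K * t ^ 2 := by
  obtain ⟨K, ρ, hK, hρ, h⟩ := exists_abs_dist_sub_norm_le (E := E) (γ 0)
  refine ⟨K * (c + 1) ^ 2, min ε (ρ / (c + 1)), by positivity, by positivity,
    fun t ht htδ s hs s' hs' => ?_⟩
  have htε : t < ε := htδ.trans_le (min_le_left _ _)
  have htρ : (c + 1) * t < ρ := by
    have := htδ.trans_le (min_le_right _ _)
    rwa [lt_div_iff₀' (by positivity)] at this
  have hball : ∀ a ∈ Icc 0 t, γ a ∈ Metric.ball (γ 0) ((c + 1) * t) := by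
    intro a ha
    rw [Metric.mem_ball, hγ a ⟨ha.1, ha.2.trans_lt htε⟩ 0 ⟨le_rfl, hε⟩, sub_zero,
      abs_of_nonneg ha.1]
    nlinarith [ha.2]
  have h1 := (h _ (by positivity) htρ _ (hball s hs) _ (hball s' hs')).2
  rw [hγ s ⟨hs.1, hs.2.trans_lt htε⟩ s' ⟨hs'.1, hs'.2.trans_lt htε⟩, abs_sub_comm] at h1
  exact h1.trans (le_of_eq (by ring))

/-- A geodesic with initial velocity `ξ` has speed `‖ξ‖`, so that it ends within `‖ξ‖` of its
starting point. -/
theorem dist_le_norm_of_isExp {ξ : TangentBundle 𝓘(ℝ, E) M} {y : M} (h : IsExp ξ y) :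
    dist ξ.1 y ≤ ‖ξ.2‖ := by
  obtain ⟨γ, v, ⟨c, hc, hg⟩, hv, rfl, rfl⟩ := h
  obtain ⟨ε, hε, hg0⟩ := hg 0 (by simp)
  obtain ⟨K, δ, hK, hδ, H⟩ := exists_abs_norm_tangentChart_sub_le (E := E) (γ := γ) hc
    (show 0 < min ε 1 by positivity) fun s hs t ht => hg0 s
      ⟨hs.1, (hs.2.trans_le (min_le_right _ _)).le⟩ t ⟨ht.1, (ht.2.trans_le (min_le_right _ _)).le⟩
      (by rw [sub_zero, abs_of_nonneg hs.1]; exact hs.2.trans_le (min_le_left _ _))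
      (by rw [sub_zero, abs_of_nonneg ht.1]; exact ht.2.trans_le (min_le_left _ _))
  have hv' := (hasMFDerivWithinAt_zero_iff hv.continuousWithinAt v).1 hv
  have hn : ‖v‖ = c := by
    refine norm_eq_of_tendsto_inv_smul hδ (K := K) (fun t ht htδ => ?_) hv'
    have := H t ht htδ t ⟨ht.le, le_rfl⟩ 0 ⟨le_rfl, ht.le⟩
    rwa [tangentChart_self, sub_zero, sub_zero, abs_of_pos ht] at this
  exact (dist_zero_one_le hg).trans_eq hn.symm

/-- A minimizing geodesic from `x` to `y` has an initial velocity, which is therefore an element of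
`y ⊖ x`. -/
theorem exists_mem_expInv_norm_eq [FiniteDimensional ℝ E] [ProperSpace M] (x y : M) :
    ∃ v ∈ expInv (E := E) x y, ‖v‖ = dist x y := by
  obtain ⟨γ, rfl, rfl, hγ⟩ :=
    (hasApproxGeodesics_of_isRiemannianManifold (E := E) (M := M)).exists_geodesic x y
  set c := dist (γ 0) (γ 1) with hc
  obtain ⟨K, δ, hK, hδ, H⟩ := exists_abs_norm_tangentChart_sub_le (E := E) (γ := γ) (c := c)
    dist_nonneg zero_lt_one fun s hs t ht => hγ s ⟨hs.1, hs.2.le⟩ t ⟨ht.1, ht.2.le⟩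
  have : CompleteSpace (TangentSpace 𝓘(ℝ, E) (γ 0)) := by
    have : FiniteDimensional ℝ (TangentSpace 𝓘(ℝ, E) (γ 0)) :=
      (tangentEquiv (E := E) (γ 0)).toLinearEquiv.finiteDimensional
    exact FiniteDimensional.complete ℝ _
  obtain ⟨v, hv⟩ := exists_tendsto_inv_smul (h := fun t => tangentChart (E := E) (γ 0) (γ t))
    dist_nonneg hK hδ (tangentChart_self _) H
  have hcont : ContinuousWithinAt γ (Icc 0 1) 0 := by
    rw [ContinuousWithinAt, tendsto_iff_dist_tendsto_zero]
    have h2 : Tendsto (fun t : ℝ => c * |t - 0|) (𝓝[Icc 0 1] 0) (𝓝 0) := by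
      have : Continuous fun t : ℝ => c * |t - 0| := by fun_prop
      have := (this.tendsto 0).mono_left (nhdsWithin_le_nhds (s := Icc 0 1))
      simpa using this
    refine h2.congr' ?_
    filter_upwards [self_mem_nhdsWithin] with t ht
    exact (hγ t ht 0 (by simp)).symm
  refine ⟨v, ⟨γ, v, ⟨c, dist_nonneg, fun t _ => ⟨1, one_pos, fun t₁ h₁ t₂ h₂ _ _ =>
    hγ t₁ h₁ t₂ h₂⟩⟩, (hasMFDerivWithinAt_zero_iff hcont v).2 hv, rfl, rfl⟩, ?_⟩
  refine norm_eq_of_tendsto_inv_smul hδ (K := K) (fun t ht htδ => ?_) hv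
  have := H t ht htδ t ⟨ht.le, le_rfl⟩ 0 ⟨le_rfl, ht.le⟩
  rwa [tangentChart_self, sub_zero, sub_zero, abs_of_pos ht] at this

end Geodesics

section Details

variable [FiniteDimensional ℝ E]
  [IsContMDiffRiemannianBundle 𝓘(ℝ, E) ∞ E (fun x : M => TangentSpace 𝓘(ℝ, E) x)]
  [IsRiemannianManifold 𝓘(ℝ, E) M] [ProperSpace M]
  {s : ℕ} {a : InterpolatoryMask s} {N' : Fin s → ℕ}

/-- There are details, and their norm is a multiple of the distance between data point and
prediction: the shortest tangent vectors that lead from a prediction to the data point are the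
initial velocities of minimizing geodesics. -/
theorem details_nonempty_and_detailNorm_eq (S : SubdivisionScheme a N') {R : ℕ}
    (u : Grid N' R → M) (r : Fin R) (n : Grid N' ((r : ℕ) + 1)) :
    (details (E := E) S u r n).Nonempty ∧ detailNorm E S u r n =
      (2 : ℝ) ^ (-((s : ℝ) * ((r : ℕ) + 1 : ℝ)) / 2) *
        Metric.infDist (sample (Nat.succ_le_of_lt r.isLt) u n)
          (S.predict (sample r.isLt.le u) n) := by
  set c := (2 : ℝ) ^ (-((s : ℝ) * ((r : ℕ) + 1 : ℝ)) / 2) with hc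
  have hc0 : 0 < c := by positivity
  set y := sample (Nat.succ_le_of_lt r.isLt) u n
  set P := S.predict (sample r.isLt.le u) n
  obtain ⟨û, hû, hd⟩ := exists_mem_intrinsicMean_infDist_eq (S.sum_weight_pos r n)
    (sample r.isLt.le u) y
  obtain ⟨w, hw, hwn⟩ := exists_mem_expInv_norm_eq (E := E) û y
  have hmin : ∀ d ∈ detailCandidates (E := E) S u r n, c * Metric.infDist y P ≤ ‖d.2‖ := by
    rintro d ⟨û', hû', w', hw', rfl⟩
    have h1 : dist û' y ≤ ‖w'‖ := dist_le_norm_of_isExp hw'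
    have h2 : Metric.infDist y P ≤ dist û' y := by
      rw [dist_comm]
      exact Metric.infDist_le_dist_of_mem hû'
    rw [norm_smul, Real.norm_of_nonneg hc0.le]
    gcongr
    exact h2.trans h1
  set d₀ : TangentBundle 𝓘(ℝ, E) M := ⟨û, c • w⟩ with hd₀
  have hd₀n : ‖d₀.2‖ = c * Metric.infDist y P := by
    show ‖c • w‖ = _
    rw [norm_smul, Real.norm_of_nonneg hc0.le, hwn, dist_comm]
    congr 1
    exact hd.symm
  have hmem : d₀ ∈ details (E := E) S u r n :=
    ⟨⟨û, hû, w, hw, rfl⟩, fun d' hd' => hd₀n.trans_le (hmin d' hd')⟩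
  refine ⟨⟨d₀, hmem⟩, ?_⟩
  have himg : (fun d : TangentBundle 𝓘(ℝ, E) M => ‖d.2‖) '' details (E := E) S u r n =
      {c * Metric.infDist y P} := by
    refine eq_singleton_iff_unique_mem.2 ⟨⟨d₀, hmem, hd₀n⟩, ?_⟩
    rintro _ ⟨d, hd, rfl⟩
    exact le_antisymm ((hd.2 d₀ hmem.1).trans_eq hd₀n) (hmin d hd.1)
  rw [detailNorm, himg, csInf_singleton]

end Details

end Velocities

end Manifold

end WaveletReg

theorem mainTheorem1
    {E : Type*} [NormedAddCommGroup E] [NormedSpace ℝ E] [FiniteDimensional ℝ E]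
    {M : Type*} [MetricSpace M] [ChartedSpace E M] [IsManifold 𝓘(ℝ, E) ∞ M]
    [Bundle.RiemannianBundle (fun x : M => TangentSpace 𝓘(ℝ, E) x)]
    [IsContMDiffRiemannianBundle 𝓘(ℝ, E) ∞ E (fun x : M => TangentSpace 𝓘(ℝ, E) x)]
    [IsRiemannianManifold 𝓘(ℝ, E) M] [CompleteSpace M] [ConnectedSpace M]
    {s : ℕ} (a : WaveletReg.InterpolatoryMask s) (N' : Fin s → ℕ)
    (S : WaveletReg.SubdivisionScheme a N') (R : ℕ)
    {κ : Type*} [Fintype κ] (A : Matrix κ (WaveletReg.Grid N' R) ℝ)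
    (hA : ∀ i, 0 < ∑ j, A i j) (f : κ → M)
    (p q α l₁ l₂ : ℝ) (hp : 0 < p) (hq : 1 ≤ q) (hl₁ : 0 < l₁) (hl₂ : 0 < l₂) :
    (∀ (u : WaveletReg.Grid N' R → M) (i : κ), (WaveletReg.imaging A u i).Nonempty) ∧
    (∀ (u : WaveletReg.Grid N' R → M) (r : Fin R) (n : WaveletReg.Grid N' ((r : ℕ) + 1)),
      (WaveletReg.details (E := E) S u r n).Nonempty) ∧
    ∃ u : WaveletReg.Grid N' R → M, ∀ v : WaveletReg.Grid N' R → M,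
      WaveletReg.dataTerm A f p u + WaveletReg.waveletReg E S α q l₁ l₂ u ≤
        WaveletReg.dataTerm A f p v + WaveletReg.waveletReg E S α q l₁ l₂ v := by
  have : LocallyCompactSpace M := Manifold.locallyCompact_of_finiteDimensional 𝓘(ℝ, E)
  have : ProperSpace M :=
    (WaveletReg.hasApproxGeodesics_of_isRiemannianManifold (E := E) (M := M)).properSpace
  refine ⟨fun u i => WaveletReg.intrinsicMean_nonempty (hA i) u, fun u r n =>
    (WaveletReg.details_nonempty_and_detailNorm_eq (E := E) S u r n).1, ?_⟩
  obtain ⟨u, hu⟩ := WaveletReg.exists_forall_dataTerm_add_predictionReg_le (M := M) S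
    (b := fun r : Fin R => (2 : ℝ) ^ (((r : ℕ) + 1 : ℝ) * q * (α + s / 2 - s / q)))
    (c := fun r : Fin R => (2 : ℝ) ^ (-((s : ℝ) * ((r : ℕ) + 1 : ℝ)) / 2))
    (fun r => by positivity) (fun r => by positivity) A hA f hp (one_pos.trans_le hq) hl₁ hl₂
  have hreg : ∀ v : WaveletReg.Grid N' R → M, WaveletReg.waveletReg E S α q l₁ l₂ v =
      WaveletReg.predictionReg S
        (fun r : Fin R => (2 : ℝ) ^ (((r : ℕ) + 1 : ℝ) * q * (α + s / 2 - s / q)))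
        (fun r : Fin R => (2 : ℝ) ^ (-((s : ℝ) * ((r : ℕ) + 1 : ℝ)) / 2)) q l₁ l₂ v := by
    intro v
    simp only [WaveletReg.waveletReg, WaveletReg.predictionReg,
      (WaveletReg.details_nonempty_and_detailNorm_eq (E := E) S v _ _).2]
  exact ⟨u, fun v => by rw [hreg, hreg]; exact hu v⟩
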